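/- **Setting.** Identify $\mathbb R^n$ with the hyperplane $H=\{x_{n+1}=0\}$ of $\mathbb R^{n+1}$ and equip $\mathbb R^{n+1}$ with the Riemannian metric $$\overline g_{ij}(x,x_{n+1})=\delta_{ij}-\frac{x_ix_j}{1+r^2},\qquad r^2=x_1^2+\dots+x_{n+1}^2,$$ of constant curvature $-1$. A *billiard table* $K\subset H$ is the closure of a nonempty connected open subset $\Omega\subset\mathbb R^n$ whose boundary is of class $C^2$, i.e. near every point of $\partial \Omega$ there are an open bounded neighborhood $U$ and $f\in C^2(\overline U)$ having $0$ as a regular value on $U$ with $\overline\Omega\cap U=\{x\in U: f(x)\ge 0\}$ and $\partial\Omega\cap U=\{x\in U:f(x)=0\}$. (Here $f\in C^2(\overline U)$ means that $f$ is $C^2$ on $U$ and its derivatives of order at most $2$ extend continuously to $\overline U$.) Given $p_0\in\partial K$, an open bounded neighborhood $U\subset H$ of $p_0$ and $f\in C^2(\overline U)$ having $0$ as a regular value on $U$ with $$K\cap U=\{x\in U: f(x)\ge 0\},\qquad \partial K\cap U=\{x\in U: f(x)=0\},\tag{1}$$ the *folds over $K\cap U$* are the hypersurfaces $$M_\lambda^{p_0}=\{(x,x_{n+1})\in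 U\times\mathbb R:\ x_{n+1}^2=\lambda^2 f(x)\},\qquad \lambda\in(0,1),$$ with the metric $g_\lambda$ induced by $\overline g$. As $f$ is only $C^2$, $M^{p_0}_\lambda$ is a hypersurface of class $C^2$ and $g_\lambda$ is of class $C^1$; its Riemann curvature tensor is the continuous tensor given in local parametrizations by the usual formula in terms of $g_\lambda$, understood in the sense of distributions. *Assumption (H)* holds for $K$ at $p_0$ if there exist $U$ and $f$ as in (1) and $\kappa\in\mathbb R$ such that, for every $\lambda\in(0,1)$, all sectional curvatures of the fold $M_\lambda^{p_0}$ over $K\cap U$ are at least $\kappa$. **Theorem.** Let $K\subset H$ be a billiard table and $p_0\in\partial K$. Assume that there are an open bounded neighborhood $U\subset H$ of $p_0$ and $f\in C^2(\overline U)$ with regular value $0$ satisfying (1), such that for every $x\in K\cap U$ $$2f(x)-x\cdot Df(x)\ \ge\ 0\qquad\text{and}\qquad D^2f(x)\ \text{is negative semidefinite},$$ where $Df$ and $D^2f$ are the Euclidean gradient and Hessian. Then, for every $\lambda\in(0,1)$, the fold $M_\lambda^{p_0}$ over $K\cap U$ is a $C^2$ hypersurface without boundary, it has a (continuous) Riemann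 curvature tensor, and all its sectional curvatures are at least $-1$ at every point. In particular, Assumption (H) holds for $K$ at $p_0$, with $\kappa=-1$. -/

import Mathlib

open Set MeasureTheory
open scoped ContDiff

namespace Billiard

/-- Euclidean space of dimension `d`. -/
abbrev E (d : ℕ) : Type := EuclideanSpace ℝ (Fin d)

/-! ### Billiard tables -/

/-- `f ∈ C²(Ū)` for an open set `U`: `f` is `C²` on `U` and all its derivatives of order at most two
extend continuously to the closure of `U`. -/
def IsC2UpToClosure {n : ℕ} (f : E n → ℝ) (U : Set (E n)) : Prop :=
  ContDiffOn ℝ 2 f U ∧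
    ∀ k : ℕ, k ≤ 2 → ∃ F : E n → ContinuousMultilinearMap ℝ (fun _ : Fin k => E n) ℝ,
      ContinuousOn F (closure U) ∧ EqOn F (iteratedFDeriv ℝ k f) U

/-- `U` is an open bounded neighbourhood of `p` and `f ∈ C²(Ū)` has `0` as a regular value and
describes the set `S` and its boundary `B` in `U`: `S ∩ U = {f ≥ 0}` and `B ∩ U = {f = 0}`. -/
structure IsDefiningFunction {n : ℕ} (S B : Set (E n)) (p : E n) (U : Set (E n)) (f : E n → ℝ) :
    Prop where
  isOpen : IsOpen U
  isBounded : Bornology.IsBounded U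
  mem : p ∈ U
  isC2 : IsC2UpToClosure f U
  regular : ∀ x ∈ U, f x = 0 → fderiv ℝ f x ≠ 0
  set_eq : S ∩ U = {x | x ∈ U ∧ 0 ≤ f x}
  boundary_eq : B ∩ U = {x | x ∈ U ∧ f x = 0}

/-- The boundary of `Ω` is of class `C²`. -/
def HasC2Boundary {n : ℕ} (Ω : Set (E n)) : Prop :=
  ∀ p ∈ frontier Ω, ∃ (U : Set (E n)) (f : E n → ℝ),
    IsDefiningFunction (closure Ω) (frontier Ω) p U f

/-- A billiard table in `ℝⁿ`: the closure of a (nonempty) open connected set with `C²` boundary. -/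
def IsBilliardTable {n : ℕ} (K : Set (E n)) : Prop :=
  ∃ Ω : Set (E n), IsOpen Ω ∧ IsConnected Ω ∧ HasC2Boundary Ω ∧ K = closure Ω

/-! ### Folds.  The hyperplane `H = {xₙ₊₁ = 0}` of `ℝⁿ⁺¹` is identified with `ℝⁿ`. -/

/-- The projection `(x, xₙ₊₁) ↦ x`. -/
def proj {n : ℕ} (q : E (n + 1)) : E n := WithLp.toLp 2 fun i => q (Fin.castSucc i)

/-- The fold `{(x, xₙ₊₁) ∈ U × ℝ : xₙ₊₁² = lam² f(x)}`. -/
def fold {n : ℕ} (U : Set (E n)) (f : E n → ℝ) (lam : ℝ) : Set (E (n + 1)) :=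
  {q | proj q ∈ U ∧ q (Fin.last n) ^ 2 = lam ^ 2 * f (proj q)}

/-! ### Curvature of a metric in coordinates.
A metric on (an open subset of) `ℝᵈ` is given by its matrix of coefficients. -/

/-- The partial derivative `∂ᵢ h`. -/
noncomputable def pd {d : ℕ} (i : Fin d) (h : E d → ℝ) (u : E d) : ℝ :=
  fderiv ℝ h u (EuclideanSpace.single i 1)

/-- The bilinear form with coefficient matrix `A`. -/
def form {d : ℕ} (A : Matrix (Fin d) (Fin d) ℝ) (v w : E d) : ℝ :=
  ∑ i, ∑ j, A i j * v i * w j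

/-- The Christoffel symbols of the first kind,
`Γ_{ij,k} = g(∇_{∂ᵢ} ∂ⱼ, ∂ₖ) = (∂ᵢ gⱼₖ + ∂ⱼ gᵢₖ - ∂ₖ gᵢⱼ) / 2`. -/
noncomputable def christoffel {d : ℕ} (g : E d → Matrix (Fin d) (Fin d) ℝ) (i j k : Fin d)
    (u : E d) : ℝ :=
  (pd i (fun y => g y j k) u + pd j (fun y => g y i k) u - pd k (fun y => g y i j) u) / 2

/-- `R` is the (continuous) Riemann curvature tensor of the `C¹` metric `g` on the open set `V`, with
the convention `R i j k l = g(R(∂ᵢ, ∂ⱼ) ∂ₖ, ∂ₗ)`. The coordinate formula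
`R i j k l = ∂ᵢ Γ_{jk,l} - ∂ⱼ Γ_{ik,l} - ∑ p q, g^{pq} (Γ_{jk,p} Γ_{il,q} - Γ_{ik,p} Γ_{jl,q})`
is required in the sense of distributions on `V`. For a `C²` metric this is the classical formula;
the metric induced on a `C²` hypersurface is in general only `C¹`, so that the Christoffel symbols
are only continuous. By continuity, `R` is unique on `V`. -/
def IsCurvatureTensor {d : ℕ} (g : E d → Matrix (Fin d) (Fin d) ℝ) (V : Set (E d))
    (R : E d → Fin d → Fin d → Fin d → Fin d → ℝ) : Prop :=
  (∀ i j k l, ContinuousOn (fun u => R u i j k l) V) ∧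
  ∀ i j k l, ∀ η : E d → ℝ, ContDiff ℝ ∞ η → HasCompactSupport η → tsupport η ⊆ V →
    ∫ u in V, R u i j k l * η u =
      ∫ u in V, (christoffel g i k l u * pd j η u - christoffel g j k l u * pd i η u
        - (∑ p, ∑ q, (g u)⁻¹ p q * (christoffel g j k p u * christoffel g i l q u
            - christoffel g i k p u * christoffel g j l q u)) * η u)

/-- The sectional curvature `R(v, w, w, v) / (g(v,v) g(w,w) - g(v,w)²)` of the plane spanned by
linearly independent vectors `v`, `w`. Here `A` is the metric and `T` the curvature tensor at the
given point. -/
noncomputable def sectionalCurvature {d : ℕ} (A : Matrix (Fin d) (Fin d) ℝ)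
    (T : Fin d → Fin d → Fin d → Fin d → ℝ) (v w : E d) : ℝ :=
  (∑ i, ∑ j, ∑ k, ∑ l, T i j k l * v i * w j * w k * v l) /
    (form A v v * form A w w - form A v w ^ 2)

/-! ### Hypersurfaces of `ℝⁿ⁺¹` with the metric induced by an ambient metric -/

/-- `φ : V → M` is a `C²` local parametrization of the hypersurface `M ⊆ ℝⁿ⁺¹` (without boundary):
an injective `C²` immersion of an open set `V ⊆ ℝⁿ` that is a homeomorphism onto a relatively open
subset of `M`. -/
structure IsLocalParam {n : ℕ} (M : Set (E (n + 1))) (V : Set (E n)) (φ : E n → E (n + 1)) :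
    Prop where
  isOpen : IsOpen V
  contDiffOn : ContDiffOn ℝ 2 φ V
  immersion : ∀ u ∈ V, Function.Injective (fderiv ℝ φ u)
  injOn : InjOn φ V
  image_open : ∀ V' ⊆ V, IsOpen V' → ∃ W : Set (E (n + 1)), IsOpen W ∧ φ '' V' = M ∩ W

/-- The coefficients of the metric induced by the ambient metric `gbar` in the parametrization `φ`,
`gᵢⱼ(u) = gbar_{φ(u)}(∂ᵢφ(u), ∂ⱼφ(u))`. -/
noncomputable def inducedMetric {n : ℕ}
    (gbar : E (n + 1) → Matrix (Fin (n + 1)) (Fin (n + 1)) ℝ) (φ : E n → E (n + 1)) (u : E n) :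
    Matrix (Fin n) (Fin n) ℝ :=
  fun i j => form (gbar (φ u)) (fderiv ℝ φ u (EuclideanSpace.single i 1))
    (fderiv ℝ φ u (EuclideanSpace.single j 1))

/-- `M`, with the metric induced by `gbar`, is a hypersurface (of class `C²`, without boundary) all
of whose sectional curvatures are at least `κ`. Since there is no boundary, this says that `M` is a
space of curvature bounded below by `κ`. -/
def CurvatureBoundedBelow {n : ℕ} (gbar : E (n + 1) → Matrix (Fin (n + 1)) (Fin (n + 1)) ℝ)
    (M : Set (E (n + 1))) (κ : ℝ) : Prop :=
  (∀ q ∈ M, ∃ (V : Set (E n)) (φ : E n → E (n + 1)), IsLocalParam M V φ ∧ q ∈ φ '' V) ∧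
  ∀ (V : Set (E n)) (φ : E n → E (n + 1)), IsLocalParam M V φ →
    ∃ R : E n → Fin n → Fin n → Fin n → Fin n → ℝ,
      IsCurvatureTensor (inducedMetric gbar φ) V R ∧
      ∀ u ∈ V, ∀ v w : E n, LinearIndependent ℝ ![v, w] →
        κ ≤ sectionalCurvature (inducedMetric gbar φ u) (R u) v w

/-- Assumption (H) for the table `K` at the boundary point `p₀`: for some open bounded neighbourhood
`U` of `p₀` (and some defining function on it), all folds over `K ∩ U` are spaces of curvature
bounded below by one and the same `κ`. -/
def AssumptionH {n : ℕ} (gbar : E (n + 1) → Matrix (Fin (n + 1)) (Fin (n + 1)) ℝ)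
    (K : Set (E n)) (p₀ : E n) : Prop :=
  ∃ (U : Set (E n)) (f : E n → ℝ), IsDefiningFunction K (frontier K) p₀ U f ∧
    ∃ κ : ℝ, ∀ lam ∈ Ioo (0 : ℝ) 1, CurvatureBoundedBelow gbar (fold U f lam) κ

/-- The hyperbolic metric `δᵢⱼ - xᵢ xⱼ / (1 + r²)`, `r² = ∑ xᵢ²`. -/
noncomputable def hyperbolicMetric {d : ℕ} (x : E d) : Matrix (Fin d) (Fin d) ℝ :=
  fun i j => (if i = j then 1 else 0) - x i * x j / (1 + ∑ k, x k ^ 2)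

end Billiard

/-! The metric `hyperbolicMetric` is the pullback of the Minkowski form under `x ↦ (x, √(1 +
‖x‖²))`, the graph chart of the hyperboloid. A `C²` parametrization `φ` of a hypersurface therefore
lifts to a `C²` map `Φ` into a flat space, with `g i j = ∑ ε ∂ᵢΦ ∂ⱼΦ` and `Γ_{ij,k} = ∑ ε ∂ᵢ∂ⱼΦ
∂ₖΦ`. In `∂ᵢΓ_{jk,l} - ∂ⱼΓ_{ik,l}` the third derivatives, which need not exist, cancel in the weak
sense. What remains is continuous and quadratic in second derivatives: the Gauss equation holds
although `g` is only `C¹` (`isCurvatureTensor_gaussCurvature`).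

Since `⟨Φ, Φ⟩ = -1`, the component of `D²Φ(v, w)` along `Φ` is `g(v, w) Φ`; this contributes
curvature `-1`. The rest is the lift of `covariantHessian`. Removing its tangential part leaves a
rank one form `s ℓ ⊗ ℓ` with `s ≥ 0` and `ℓ` a conormal
(`exists_contract_hypersurfaceCurvature_eq`). Hence the curvature is at least `-1` as soon as `ℓ ∘
covariantHessian` is semidefinite.

For the fold take `ℓ = DF(q)` with `F = xₙ₊₁² - lam² f ∘ proj`. Differentiating `F ∘ φ = 0` twice
turns `ℓ ∘ covariantHessian` into minus the form `D²F + (DF(q) q) h`, where `h` is the hyperbolic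
metric at `q`. Concavity of `f` gives `D²F ≥ 0`, and on the fold `DF(q) q = lam² (2f - x · Df) ≥ 0`
(`foldHessian_nonneg`). -/

namespace Billiard

/-! ### Weak calculus for functions of class C¹ and C² -/

open scoped Convolution in
/-- The derivative of a convolution, carried by the second factor. -/
lemma fderiv_convolution_right {d : ℕ} {f g : E d → ℝ} (hf : Continuous f)
    (hg : ContDiff ℝ 1 g) (hgc : HasCompactSupport g) (v x : E d) :
    fderiv ℝ (f ⋆[ContinuousLinearMap.mul ℝ ℝ, volume] g) x v
      = (f ⋆[ContinuousLinearMap.mul ℝ ℝ, volume] fun y => fderiv ℝ g y v) x := by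
  rw [(hgc.hasFDerivAt_convolution_right (ContinuousLinearMap.mul ℝ ℝ) hf.locallyIntegrable hg x).fderiv,
    convolution_precompR_apply _ hf.locallyIntegrable (hgc.fderiv ℝ)
      (hg.continuous_fderiv one_ne_zero)]

open scoped Convolution in
/-- The derivative of a convolution, carried by the first factor. -/
lemma fderiv_convolution_left {d : ℕ} {f g : E d → ℝ} (hf : ContDiff ℝ 1 f)
    (hfc : HasCompactSupport f) (hg : Continuous g) (v x : E d) :
    fderiv ℝ (f ⋆[ContinuousLinearMap.mul ℝ ℝ, volume] g) x v
      = ((fun y => fderiv ℝ f y v) ⋆[ContinuousLinearMap.mul ℝ ℝ, volume] g) x := by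
  have hflip : (ContinuousLinearMap.mul ℝ ℝ).flip = ContinuousLinearMap.mul ℝ ℝ := by
    ext; simp
  rw [← convolution_flip, ← convolution_flip (g := g), hflip]
  exact fderiv_convolution_right hg hf hfc v x

open scoped Convolution in
/-- Second derivatives commute in the weak sense for `C¹` functions. -/
lemma integral_fderiv_mul_fderiv_comm {d : ℕ} {u ψ : E d → ℝ} (hu : ContDiff ℝ 1 u)
    (huc : HasCompactSupport u) (hψ : ContDiff ℝ 1 ψ) (hψc : HasCompactSupport ψ) (v w : E d) :
    ∫ x, fderiv ℝ u x v * fderiv ℝ ψ x w = ∫ x, fderiv ℝ u x w * fderiv ℝ ψ x v := by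
  -- After reflecting `ψ`, the convolution at `0` is the pairing `∫ u ψ`.
  set B : E d → ℝ := fun x => ψ (-x) with hB
  have hB1 : ContDiff ℝ 1 B := hψ.comp contDiff_neg
  have hBc : HasCompactSupport B := hψc.comp_homeomorph (Homeomorph.neg (E d))
  have hBd : ∀ x z, fderiv ℝ B x z = -fderiv ℝ ψ (-x) z := fun x z => by
    have h := ((hψ.differentiable one_ne_zero (-x)).hasFDerivAt.comp x ((hasFDerivAt_id (𝕜 := ℝ) x).fun_neg)).fderiv
    refine (DFunLike.congr_fun h z).trans ?_
    simp
  have hcont : ∀ (h : E d → ℝ) (z : E d), ContDiff ℝ 1 h → Continuous fun y => fderiv ℝ h y z :=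
    fun h z hh => (hh.continuous_fderiv one_ne_zero).clm_apply continuous_const
  -- Both sides are the `v`-derivative at `0` of `∂_w (u ⋆ B)`, since each derivative of a
  -- convolution may fall on either factor.
  have key : ((fun y => fderiv ℝ u y v) ⋆[ContinuousLinearMap.mul ℝ ℝ, volume]
        fun y => fderiv ℝ B y w) 0 =
      ((fun y => fderiv ℝ u y w) ⋆[ContinuousLinearMap.mul ℝ ℝ, volume]
        fun y => fderiv ℝ B y v) 0 := by
    rw [← fderiv_convolution_left hu huc (hcont B w hB1),
      ← fderiv_convolution_right (hcont u w hu) hB1 hBc]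
    congr 2
    funext x
    rw [← fderiv_convolution_left hu huc hB1.continuous,
      ← fderiv_convolution_right hu.continuous hB1 hBc]
  simpa [convolution_def, hBd, integral_neg] using key

/-- A function that is `C^m` on an open set agrees near a compact subset with a globally defined
compactly supported `C^m` function. -/
lemma exists_contDiff_hasCompactSupport_eventuallyEq {d : ℕ} {V C : Set (E d)} (hV : IsOpen V)
    (hC : IsCompact C) (hCV : C ⊆ V) {h : E d → ℝ} {m : ℕ∞} (hh : ContDiffOn ℝ m h V) :
    ∃ h' : E d → ℝ, ContDiff ℝ m h' ∧ HasCompactSupport h' ∧ ∀ x ∈ C, h' =ᶠ[nhds x] h := by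
  obtain ⟨L, hL, hCL, hLV⟩ := exists_compact_between hC hV hCV
  obtain ⟨χ, h1, h0, -⟩ := exists_contMDiffMap_one_nhds_of_subset_interior (n := m)
    (modelWithCornersSelf ℝ (E d)) hC.isClosed hCL
  have hts : tsupport χ ⊆ L := closure_minimal (fun x hx => by_contra fun hxL => hx (h0 x hxL))
    hL.isClosed
  have hts' : tsupport (fun x => χ x * h x) ⊆ tsupport χ := tsupport_mul_subset_left
  refine ⟨fun x => χ x * h x, contDiff_iff_contDiffAt.2 fun x => ?_,
    hL.of_isClosed_subset (isClosed_tsupport _) (hts'.trans hts), fun x hx => ?_⟩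
  · by_cases hx : x ∈ tsupport fun x => χ x * h x
    · exact χ.contMDiff.contDiff.contDiffAt.mul
        (hh.contDiffAt (hV.mem_nhds (hLV (hts (hts' hx)))))
    · exact contDiffAt_const.congr_of_eventuallyEq (notMem_tsupport_iff_eventuallyEq.1 hx)
  · filter_upwards [Filter.Eventually.filter_mono (nhds_le_nhdsSet hx) h1] with y hy
    simp [hy]

lemma continuous_mul_of_tsupport_subset {d : ℕ} {V : Set (E d)} (hV : IsOpen V) {F h : E d → ℝ}
    (hF : ContinuousOn F V) (hh : Continuous h) (hhV : tsupport h ⊆ V) :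
    Continuous fun x => F x * h x :=
  (hF.mul hh.continuousOn).continuous_of_tsupport_subset hV (tsupport_mul_subset_right.trans hhV)

lemma integrable_mul_of_tsupport_subset {d : ℕ} {V : Set (E d)} (hV : IsOpen V) {F h : E d → ℝ}
    (hF : ContinuousOn F V) (hh : Continuous h) (hhc : HasCompactSupport h) (hhV : tsupport h ⊆ V) :
    Integrable fun x => F x * h x :=
  (continuous_mul_of_tsupport_subset hV hF hh hhV).integrable_of_hasCompactSupport hhc.mul_left

lemma _root_.ContDiff.pd {d : ℕ} {h : E d → ℝ} {m : ℕ∞} (hh : ContDiff ℝ (m + 1) h) (i : Fin d) :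
    ContDiff ℝ m (pd i h) :=
  (hh.fderiv_right le_rfl).clm_apply contDiff_const

lemma _root_.ContDiffOn.pd {d : ℕ} {V : Set (E d)} (hV : IsOpen V) {h : E d → ℝ} {m : ℕ∞}
    (hh : ContDiffOn ℝ (m + 1) h V) (i : Fin d) : ContDiffOn ℝ m (pd i h) V :=
  (hh.fderiv_of_isOpen hV le_rfl).clm_apply contDiffOn_const

lemma _root_.HasCompactSupport.pd {d : ℕ} {h : E d → ℝ} (hh : HasCompactSupport h) (i : Fin d) :
    HasCompactSupport (pd i h) := hh.fderiv_apply ℝ _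

lemma _root_.Filter.EventuallyEq.pd {d : ℕ} {h h' : E d → ℝ} {x : E d} (hh : h =ᶠ[nhds x] h')
    (i : Fin d) : pd i h =ᶠ[nhds x] pd i h' := by
  filter_upwards [hh.fderiv (𝕜 := ℝ)] with y hy
  simp only [Billiard.pd, hy]

lemma pd_mul {d : ℕ} {f h : E d → ℝ} {x : E d} (hf : DifferentiableAt ℝ f x)
    (hh : DifferentiableAt ℝ h x) (i : Fin d) :
    pd i (fun y => f y * h y) x = f x * pd i h x + h x * pd i f x := by
  simp [pd, fderiv_fun_mul hf hh]

lemma pd_pd {d : ℕ} {h : E d → ℝ} {x : E d} (hh : ContDiffAt ℝ 2 h x) (i j : Fin d) :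
    pd i (pd j h) x = fderiv ℝ (fderiv ℝ h) x (EuclideanSpace.single i 1)
      (EuclideanSpace.single j 1) := by
  have h1 : DifferentiableAt ℝ (fderiv ℝ h) x :=
    (hh.fderiv_right (m := 1) (by norm_num)).differentiableAt one_ne_zero
  have := (h1.hasFDerivAt.clm_apply
    (hasFDerivAt_const (EuclideanSpace.single j (1 : ℝ)) x)).fderiv
  exact (DFunLike.congr_fun this _).trans (by simp)

lemma pd_comm {d : ℕ} {h : E d → ℝ} {x : E d} (hh : ContDiffAt ℝ 2 h x) (i j : Fin d) :
    pd i (pd j h) x = pd j (pd i h) x := by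
  rw [pd_pd hh, pd_pd hh]
  exact hh.isSymmSndFDerivAt (by simp) _ _

/-- The weak form of `∂ⱼ(∂ᵢ∂ₖh ∂ₗh) - ∂ᵢ(∂ⱼ∂ₖh ∂ₗh) = ∂ᵢ∂ₖh ∂ⱼ∂ₗh - ∂ⱼ∂ₖh ∂ᵢ∂ₗh` for `h` of class
`C²`. -/
lemma integral_pd_pd_mul_pd_pd_sub {d : ℕ} {V : Set (E d)} (hV : IsOpen V) {h η : E d → ℝ}
    (hh : ContDiffOn ℝ 2 h V) (hη : ContDiff ℝ ∞ η) (hηc : HasCompactSupport η)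
    (hηV : tsupport η ⊆ V) (i j k l : Fin d) :
    ∫ x, ((pd j (pd k h) x * pd i (pd l h) x - pd i (pd k h) x * pd j (pd l h) x) * η x
      - (pd i (pd k h) x * pd l h x * pd j η x - pd j (pd k h) x * pd l h x * pd i η x)) = 0 := by
  obtain ⟨h', hh', hc', he⟩ :=
    exists_contDiff_hasCompactSupport_eventuallyEq (m := 2) hV hηc hηV hh
  have h1 : ∀ m, ContDiff ℝ 1 (pd m h') := fun m => ContDiff.pd (m := 1) hh' m
  have hη1 : ContDiff ℝ 1 η := hη.of_le (by exact_mod_cast le_top)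
  -- The commutation is applied to `∂ₖh'` and `∂ₗh' η`, both only `C¹`. Expanding the product rule,
  -- the terms with `∂η` are the weak derivatives and the others form the quadratic expression.
  have hψ : ContDiff ℝ 1 fun x => pd l h' x * η x := (h1 l).mul hη1
  have key : ∫ x, pd i (pd k h') x * pd j (fun x => pd l h' x * η x) x =
      ∫ x, pd j (pd k h') x * pd i (fun x => pd l h' x * η x) x :=
    integral_fderiv_mul_fderiv_comm (h1 k) (hc'.pd k) hψ hηc.mul_left
    (EuclideanSpace.single i 1) (EuclideanSpace.single j 1)
  have hint : ∀ a b : Fin d, Integrable fun x =>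
      pd a (pd k h') x * pd b (fun x => pd l h' x * η x) x := fun a b =>
    Continuous.integrable_of_hasCompactSupport
      (((h1 k).pd (m := 0) a).continuous.mul (ContDiff.pd (m := 0) hψ b).continuous)
      (HasCompactSupport.pd hηc.mul_left b).mul_left
  rw [← sub_eq_zero, ← integral_sub (hint i j) (hint j i)] at key
  rw [← neg_eq_zero, ← integral_neg, ← key]
  congr 1
  funext x
  have e1 : ∀ m, pd m (fun x => pd l h' x * η x) x = pd l h' x * pd m η x + η x * pd m (pd l h') x :=
    pd_mul ((h1 l).differentiable one_ne_zero x) (hη1.differentiable one_ne_zero x)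
  change _ = pd i (pd k h') x * pd j (fun x => pd l h' x * η x) x -
    pd j (pd k h') x * pd i (fun x => pd l h' x * η x) x
  rw [e1, e1]
  by_cases hx : x ∈ tsupport η
  · have e2 := he x hx
    have e3 : ∀ a b, pd a (pd b h) x = pd a (pd b h') x :=
      fun a b => ((e2.pd b).pd a).eq_of_nhds.symm
    rw [e3, e3, e3, e3, ← (e2.pd l).eq_of_nhds]
    ring
  · have e2 := notMem_tsupport_iff_eventuallyEq.1 hx
    have e3 : ∀ a, pd a η x = 0 := fun a => by
      rw [(e2.pd a).eq_of_nhds]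
      simp [pd]
    simp [e3, image_eq_zero_of_notMem_tsupport hx]

/-! ### Curvature of a pullback of a flat metric -/

section Gauss

variable {d : ℕ} {ι : Type*} [Fintype ι] {ε : ι → ℝ} {Φ : ι → E d → ℝ} {V : Set (E d)}
  {g : E d → Matrix (Fin d) (Fin d) ℝ}

/-- The Christoffel symbols of a metric that is the pullback of a flat one. -/
lemma christoffel_eq_sum (hV : IsOpen V) (hΦ : ∀ a, ContDiffOn ℝ 2 (Φ a) V)
    (hg : ∀ u ∈ V, ∀ i j, g u i j = ∑ a, ε a * (pd i (Φ a) u * pd j (Φ a) u))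
    {u : E d} (hu : u ∈ V) (i j k : Fin d) :
    christoffel g i j k u = ∑ a, ε a * (pd i (pd j (Φ a)) u * pd k (Φ a) u) := by
  have hc : ∀ a, ContDiffAt ℝ 2 (Φ a) u := fun a => (hΦ a).contDiffAt (hV.mem_nhds hu)
  have h1 : ∀ a m, DifferentiableAt ℝ (pd m (Φ a)) u := fun a m =>
    ((ContDiffOn.pd (m := 1) hV (hΦ a) m).contDiffAt (hV.mem_nhds hu)).differentiableAt one_ne_zero
  have hd : ∀ i j k, pd k (fun y => g y i j) u = ∑ a, ε a *
      (pd i (Φ a) u * pd k (pd j (Φ a)) u + pd j (Φ a) u * pd k (pd i (Φ a)) u) := by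
    intro i j k
    have he : (fun y => g y i j) =ᶠ[nhds u]
        fun y => ∑ a, ε a * (pd i (Φ a) y * pd j (Φ a) y) := by
      filter_upwards [hV.mem_nhds hu] with y hy using hg y hy i j
    rw [(he.pd k).eq_of_nhds, pd,
      fderiv_fun_sum fun a _ => ((h1 a i).fun_mul (h1 a j)).const_mul (ε a)]
    rw [sum_apply]
    refine Finset.sum_congr rfl fun a _ => ?_
    rw [fderiv_const_mul ((h1 a i).fun_mul (h1 a j)), smul_apply, smul_eq_mul]
    congr 1
    exact pd_mul (h1 a i) (h1 a j) k
  simp only [christoffel, hd]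
  rw [← Finset.sum_add_distrib, ← Finset.sum_sub_distrib, Finset.sum_div]
  refine Finset.sum_congr rfl fun a _ => ?_
  rw [pd_comm (hc a) k j, pd_comm (hc a) k i, pd_comm (hc a) j i]
  ring

/-- The Gauss equation: the curvature tensor of a metric that is the pullback of a flat one. -/
noncomputable def gaussCurvature (ε : ι → ℝ) (Φ : ι → E d → ℝ)
    (g : E d → Matrix (Fin d) (Fin d) ℝ) (u : E d) (i j k l : Fin d) : ℝ :=
  (∑ a, ε a * (pd j (pd k (Φ a)) u * pd i (pd l (Φ a)) u
      - pd i (pd k (Φ a)) u * pd j (pd l (Φ a)) u))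
    - ∑ p, ∑ q, (g u)⁻¹ p q * (christoffel g j k p u * christoffel g i l q u
        - christoffel g i k p u * christoffel g j l q u)

lemma continuousOn_inv_apply (hgc : ∀ i j, ContinuousOn (fun u => g u i j) V)
    (hdet : ∀ u ∈ V, (g u).det ≠ 0) (p q : Fin d) : ContinuousOn (fun u => (g u)⁻¹ p q) V := by
  have hm : ContinuousOn g V := continuousOn_pi.2 fun i => continuousOn_pi.2 fun j => hgc i j
  have h1 : ContinuousOn (fun u => (g u).det) V :=
    (Continuous.matrix_det continuous_id).comp_continuousOn hm
  have h2 : ContinuousOn (fun u => (g u).adjugate p q) V :=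
    ((Continuous.matrix_adjugate continuous_id).matrix_elem p q).comp_continuousOn hm
  refine ((h1.inv₀ hdet).mul h2).congr fun u _ => ?_
  simp [Matrix.inv_def, Ring.inverse_eq_inv]

/-- The terms quadratic in Christoffel symbols are common to both sides, so only the weak identity
for second derivatives is needed, one component of `Φ` at a time. No regularity beyond `C²` enters.
-/
theorem isCurvatureTensor_gaussCurvature (hV : IsOpen V) (hΦ : ∀ a, ContDiffOn ℝ 2 (Φ a) V)
    (hg : ∀ u ∈ V, ∀ i j, g u i j = ∑ a, ε a * (pd i (Φ a) u * pd j (Φ a) u))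
    (hdet : ∀ u ∈ V, (g u).det ≠ 0) :
    IsCurvatureTensor g V (gaussCurvature ε Φ g) := by
  have c1 : ∀ a m, ContinuousOn (pd m (Φ a)) V := fun a m =>
    (ContDiffOn.pd (m := 1) hV (hΦ a) m).continuousOn
  have c2 : ∀ a m r, ContinuousOn (pd m (pd r (Φ a))) V := fun a m r =>
    (ContDiffOn.pd (m := 0) hV (ContDiffOn.pd (m := 1) hV (hΦ a) r) m).continuousOn
  have cg : ∀ i j, ContinuousOn (fun u => g u i j) V := fun i j => by
    refine ContinuousOn.congr ?_ fun u hu => hg u hu i j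
    fun_prop
  have cΓ : ∀ i j k, ContinuousOn (christoffel g i j k) V := fun i j k => by
    refine ContinuousOn.congr ?_ fun u hu => christoffel_eq_sum hV hΦ hg hu i j k
    fun_prop
  have cinv := continuousOn_inv_apply cg hdet
  have cQ : ∀ i j k l, ContinuousOn (fun u => ∑ p, ∑ q, (g u)⁻¹ p q *
      (christoffel g j k p u * christoffel g i l q u
        - christoffel g i k p u * christoffel g j l q u)) V := fun i j k l =>
    continuousOn_finsetSum _ fun p _ => continuousOn_finsetSum _ fun q _ =>
      (cinv p q).mul (((cΓ j k p).mul (cΓ i l q)).sub ((cΓ i k p).mul (cΓ j l q)))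
  have cS : ∀ i j k l, ContinuousOn (fun u => ∑ a, ε a * (pd j (pd k (Φ a)) u * pd i (pd l (Φ a)) u
      - pd i (pd k (Φ a)) u * pd j (pd l (Φ a)) u)) V := fun i j k l => by
    fun_prop
  refine ⟨fun i j k l => (cS i j k l).sub (cQ i j k l), fun i j k l η hη hηc hηV => ?_⟩
  have hη1 : ContDiff ℝ 1 η := hη.of_le (by exact_mod_cast le_top)
  have cη : ∀ m, Continuous (pd m η) := fun m => (ContDiff.pd (m := 0) hη1 m).continuous
  have sη : ∀ m, tsupport (pd m η) ⊆ V := fun m => (tsupport_fderiv_apply_subset ℝ _).trans hηV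
  have zη : ∀ u ∉ V, η u = 0 := fun u hu => image_eq_zero_of_notMem_tsupport fun h => hu (hηV h)
  have zη' : ∀ m, ∀ u ∉ V, pd m η u = 0 := fun m u hu =>
    image_eq_zero_of_notMem_tsupport fun h => hu (sη m h)
  have iη : ∀ F : E d → ℝ, ContinuousOn F V → Integrable fun u => F u * η u := fun F hF =>
    integrable_mul_of_tsupport_subset hV hF hη.continuous hηc hηV
  have iη' : ∀ F : E d → ℝ, ContinuousOn F V → ∀ m, Integrable fun u => F u * pd m η u :=
    fun F hF m => integrable_mul_of_tsupport_subset hV hF (cη m) (hηc.pd m) (sη m)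
  rw [setIntegral_eq_integral_of_forall_compl_eq_zero fun u hu => by simp [zη u hu],
    setIntegral_eq_integral_of_forall_compl_eq_zero fun u hu => by
      simp [zη u hu, zη' _ u hu]]
  -- The difference of the two sides becomes one integral, which is a sum over `a` of integrals that
  -- vanish.
  refine sub_eq_zero.1 ((integral_sub (iη _ ((cS i j k l).sub (cQ i j k l)))
      (((iη' _ (cΓ i k l) j).sub (iη' _ (cΓ j k l) i)).sub (iη _ (cQ i j k l)))).symm.trans ?_)
  have key : ∀ a, ∫ u, ε a * ((pd j (pd k (Φ a)) u * pd i (pd l (Φ a)) u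
      - pd i (pd k (Φ a)) u * pd j (pd l (Φ a)) u) * η u
      - (pd i (pd k (Φ a)) u * pd l (Φ a) u * pd j η u
        - pd j (pd k (Φ a)) u * pd l (Φ a) u * pd i η u)) = 0 := fun a => by
    rw [integral_const_mul, integral_pd_pd_mul_pd_pd_sub hV (hΦ a) hη hηc hηV, mul_zero]
  have hsum := integral_finsetSum Finset.univ (fun a _ => Integrable.const_mul
    ((iη _ (((c2 a j k).mul (c2 a i l)).sub ((c2 a i k).mul (c2 a j l)))).sub
      ((iη' _ ((c2 a i k).mul (c1 a l)) j).sub (iη' _ ((c2 a j k).mul (c1 a l)) i))) (ε a))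
    (μ := volume)
  refine Eq.trans ?_ (hsum.trans (Finset.sum_eq_zero fun a _ => key a))
  congr 1
  funext u
  by_cases hu : u ∈ V
  · simp only [christoffel_eq_sum hV hΦ hg hu i k l,
      christoffel_eq_sum hV hΦ hg hu j k l, sub_mul, Finset.sum_mul, mul_sub,
      Finset.sum_sub_distrib, Pi.mul_apply, Pi.sub_apply, mul_assoc]
    ring
  · simp [zη u hu, zη' _ u hu]

end Gauss

/-! ### Contraction of the curvature tensor with two vectors -/

section Contraction

variable {d : ℕ}

/-- The contraction `T(v, w, w, v)`. -/
def contract (T : Fin d → Fin d → Fin d → Fin d → ℝ) (v w : E d) : ℝ :=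
  ∑ i, ∑ j, ∑ k, ∑ l, T i j k l * v i * w j * w k * v l

lemma contract_sub (T S : Fin d → Fin d → Fin d → Fin d → ℝ) (v w : E d) :
    contract (fun i j k l => T i j k l - S i j k l) v w = contract T v w - contract S v w := by
  simp only [contract, sub_mul, Finset.sum_sub_distrib]

lemma contract_add (T S : Fin d → Fin d → Fin d → Fin d → ℝ) (v w : E d) :
    contract (fun i j k l => T i j k l + S i j k l) v w = contract T v w + contract S v w := by
  simp only [contract, add_mul, Finset.sum_add_distrib]

lemma contract_sum {ι : Type*} (s : Finset ι) (T : ι → Fin d → Fin d → Fin d → Fin d → ℝ)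
    (v w : E d) :
    contract (fun i j k l => ∑ a ∈ s, T a i j k l) v w = ∑ a ∈ s, contract (T a) v w := by
  classical
  induction s using Finset.induction_on with
  | empty => simp [contract]
  | insert a s ha ih => simp only [Finset.sum_insert ha, contract_add, ih]

lemma contract_const_mul (c : ℝ) (T : Fin d → Fin d → Fin d → Fin d → ℝ) (v w : E d) :
    contract (fun i j k l => c * T i j k l) v w = c * contract T v w := by
  simp only [contract, Finset.mul_sum, mul_assoc]

lemma contract_outer (X Y : Fin d → Fin d → ℝ) (v w : E d) :
    contract (fun i j k l => X j k * Y i l) v w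
      = (∑ j, ∑ k, X j k * w j * w k) * ∑ i, ∑ l, Y i l * v i * v l := by
  simp only [contract, Finset.sum_mul]
  simp only [Finset.mul_sum]
  rw [Finset.sum_comm]
  refine Finset.sum_congr rfl fun j _ => ?_
  rw [Finset.sum_comm]
  refine Finset.sum_congr rfl fun k _ => Finset.sum_congr rfl fun i _ =>
    Finset.sum_congr rfl fun l _ => ?_
  ring

lemma contract_cross (X Y : Fin d → Fin d → ℝ) (v w : E d) :
    contract (fun i j k l => X i k * Y j l) v w
      = (∑ i, ∑ k, X i k * v i * w k) * ∑ j, ∑ l, Y j l * w j * v l := by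
  simp only [contract, Finset.sum_mul]
  simp only [Finset.mul_sum]
  refine Finset.sum_congr rfl fun i _ => ?_
  rw [Finset.sum_comm]
  refine Finset.sum_congr rfl fun k _ => Finset.sum_congr rfl fun i _ =>
    Finset.sum_congr rfl fun l _ => ?_
  ring

lemma map_eq_sum_single {F : Type*} [AddCommGroup F] [Module ℝ F] [TopologicalSpace F]
    (L : E d →L[ℝ] F) (v : E d) : L v = ∑ i, v i • L (EuclideanSpace.single i 1) := by
  conv_lhs => rw [← (EuclideanSpace.basisFun (Fin d) ℝ).sum_repr v]
  simp

lemma sum_pd_pd_mul {h : E d → ℝ} {x : E d} (hh : ContDiffAt ℝ 2 h x) (v w : E d) :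
    ∑ i, ∑ j, pd i (pd j h) x * v i * w j = fderiv ℝ (fderiv ℝ h) x v w := by
  rw [map_eq_sum_single (fderiv ℝ (fderiv ℝ h) x) v, sum_apply]
  refine Finset.sum_congr rfl fun i _ => ?_
  rw [smul_apply, map_eq_sum_single (fderiv ℝ (fderiv ℝ h) x _) w, Finset.smul_sum]
  refine Finset.sum_congr rfl fun j _ => ?_
  rw [pd_pd hh, smul_eq_mul, smul_eq_mul]
  ring

variable {ι : Type*} [Fintype ι] {ε : ι → ℝ} {Φ : ι → E d → ℝ} {V : Set (E d)}
  {g : E d → Matrix (Fin d) (Fin d) ℝ}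

lemma sum_christoffel_mul (hV : IsOpen V) (hΦ : ∀ a, ContDiffOn ℝ 2 (Φ a) V)
    (hg : ∀ u ∈ V, ∀ i j, g u i j = ∑ a, ε a * (pd i (Φ a) u * pd j (Φ a) u))
    {u : E d} (hu : u ∈ V) (v w : E d) (p : Fin d) :
    ∑ i, ∑ j, christoffel g i j p u * v i * w j
      = ∑ a, ε a * (fderiv ℝ (fderiv ℝ (Φ a)) u v w * pd p (Φ a) u) := by
  simp only [christoffel_eq_sum hV hΦ hg hu, Finset.sum_mul,
    ← sum_pd_pd_mul ((hΦ _).contDiffAt (hV.mem_nhds hu)), Finset.mul_sum]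
  symm
  rw [Finset.sum_comm]
  refine Finset.sum_congr rfl fun i _ => ?_
  rw [Finset.sum_comm]
  refine Finset.sum_congr rfl fun j _ => Finset.sum_congr rfl fun a _ => ?_
  ring

/-- Every product in the Gauss formula pairs the indices as `(j,k),(i,l)` or `(i,k),(j,l)`, so
contraction factorizes into values of second derivatives at `v` and `w`. -/
lemma contract_gaussCurvature (hV : IsOpen V) (hΦ : ∀ a, ContDiffOn ℝ 2 (Φ a) V)
    {u : E d} (hu : u ∈ V) (v w : E d) :
    contract (gaussCurvature ε Φ g u) v w
      = ∑ a, ε a * (fderiv ℝ (fderiv ℝ (Φ a)) u w w * fderiv ℝ (fderiv ℝ (Φ a)) u v v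
          - fderiv ℝ (fderiv ℝ (Φ a)) u v w * fderiv ℝ (fderiv ℝ (Φ a)) u w v)
        - ∑ p, ∑ q, (g u)⁻¹ p q *
          ((∑ i, ∑ j, christoffel g i j p u * w i * w j) *
              (∑ i, ∑ j, christoffel g i j q u * v i * v j)
            - (∑ i, ∑ j, christoffel g i j p u * v i * w j) *
              (∑ i, ∑ j, christoffel g i j q u * w i * v j)) := by
  simp only [← sum_pd_pd_mul ((hΦ _).contDiffAt (hV.mem_nhds hu)), ← contract_outer,
    ← contract_cross, ← contract_sub, ← contract_const_mul, ← contract_sum]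
  rfl

end Contraction

/-! ### Gram matrices and orthogonal projection -/

section LinearAlgebra

variable {W : Type*} [AddCommGroup W] [Module ℝ W] {d : ℕ}

/-- The projection of a positive semidefinite form along a hyperplane `ker ℓ` spanned by vectors
with invertible Gram matrix is a nonnegative multiple of `ℓ ⊗ ℓ`. -/
lemma exists_sub_sum_gram_inv_eq (b : LinearMap.BilinForm ℝ W) (hb : ∀ x, 0 ≤ b x x)
    (hs : ∀ x y, b x y = b y x) (e : Fin d → W) (G : Matrix (Fin d) (Fin d) ℝ)
    (hG : ∀ i j, G i j = b (e i) (e j)) (hdet : G.det ≠ 0) (ℓ : W →ₗ[ℝ] ℝ) (hℓ : ℓ ≠ 0)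
    (hker : LinearMap.ker ℓ ≤ Submodule.span ℝ (range e)) :
    ∃ s : ℝ, 0 ≤ s ∧ ∀ x y, b x y - ∑ p, ∑ q, G⁻¹ p q * (b x (e p) * b y (e q)) = s * (ℓ x * ℓ y) := by
  have hu : IsUnit G.det := hdet.isUnit
  -- `Q x y` pairs the components of `x` and `y` orthogonal to the span of `e`; it vanishes when
  -- either argument is some `e r`, so it factors through `ℓ`.
  let Q : LinearMap.BilinForm ℝ W :=
    b - ∑ p, ∑ q, G⁻¹ p q • LinearMap.BilinForm.linMulLin (b.flip (e p)) (b.flip (e q))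
  have hQ : ∀ x y, Q x y = b x y - ∑ p, ∑ q, G⁻¹ p q * (b x (e p) * b y (e q)) := fun x y => by
    simp [Q, LinearMap.sum_apply]
  have hQl : ∀ r y, Q (e r) y = 0 := fun r y => by
    have h1 : ∀ q, ∑ p, G r p * G⁻¹ p q = (1 : Matrix _ _ ℝ) r q := fun q => by
      rw [← Matrix.mul_apply, Matrix.mul_nonsing_inv _ hu]
    rw [hQ, Finset.sum_comm]
    have h2 : ∀ q, ∑ p, G⁻¹ p q * (b (e r) (e p) * b y (e q)) =
        (1 : Matrix _ _ ℝ) r q * b y (e q) := fun q => by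
      rw [← h1, Finset.sum_mul]
      exact Finset.sum_congr rfl fun p _ => by rw [hG]; ring
    rw [Finset.sum_congr rfl fun q _ => h2 q]
    simp [Matrix.one_apply, hs y]
  have hQr : ∀ r x, Q x (e r) = 0 := fun r x => by
    have h1 : ∀ p, ∑ q, G⁻¹ p q * G q r = (1 : Matrix _ _ ℝ) p r := fun p => by
      rw [← Matrix.mul_apply, Matrix.nonsing_inv_mul _ hu]
    rw [hQ]
    have h2 : ∀ p, ∑ q, G⁻¹ p q * (b x (e p) * b (e r) (e q)) =
        (1 : Matrix _ _ ℝ) p r * b x (e p) := fun p => by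
      rw [← h1, Finset.sum_mul]
      exact Finset.sum_congr rfl fun q _ => by rw [hG, hs (e r)]; ring
    simp [h2, Matrix.one_apply]
  have hkl : ∀ x ∈ Submodule.span ℝ (range e), ∀ y, Q x y = 0 := fun x hx y => by
    have : Submodule.span ℝ (range e) ≤ LinearMap.ker (Q.flip y) :=
      Submodule.span_le.2 (by rintro _ ⟨r, rfl⟩; exact hQl r y)
    exact this hx
  have hkr : ∀ y ∈ Submodule.span ℝ (range e), ∀ x, Q x y = 0 := fun y hy x => by
    have : Submodule.span ℝ (range e) ≤ LinearMap.ker (Q x) :=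
      Submodule.span_le.2 (by rintro _ ⟨r, rfl⟩; exact hQr r x)
    exact this hy
  obtain ⟨m, hm⟩ : ∃ m, ℓ m = 1 := by
    obtain ⟨z, hz⟩ : ∃ z, ℓ z ≠ 0 := by
      by_contra! h
      exact hℓ (LinearMap.ext h)
    exact ⟨(ℓ z)⁻¹ • z, by simp [hz]⟩
  refine ⟨Q m m, ?_, fun x y => ?_⟩
  -- `z` is the orthogonal projection of `m` to the span, so the coefficient `Q m m` is the square
  -- length of `m - z`.
  · set z := ∑ p, ∑ q, (G⁻¹ p q * b m (e p)) • e q with hz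
    have hzs : z ∈ Submodule.span ℝ (range e) :=
      Submodule.sum_mem _ fun p _ => Submodule.sum_mem _ fun q _ =>
        Submodule.smul_mem _ _ (Submodule.subset_span (mem_range_self q))
    have hort : ∀ r, b (m - z) (e r) = 0 := fun r => by
      rw [← hQr r m, hQ, map_sub, LinearMap.sub_apply, hz]
      simp [LinearMap.sum_apply, hs (e r), mul_assoc]
    have h1 : Q m m = b (m - z) (m - z) := by
      have h2 := hQ (m - z) (m - z)
      simp only [hort, mul_zero, Finset.sum_const_zero, sub_zero] at h2
      rw [← h2]
      simp [hkl z hzs, hkr z hzs]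
    rw [h1]
    exact hb _
  · rw [← hQ]
    have hx : x - ℓ x • m ∈ Submodule.span ℝ (range e) := hker (by simp [hm])
    have hy : y - ℓ y • m ∈ Submodule.span ℝ (range e) := hker (by simp [hm])
    have h1 := hkl _ hx y
    have h2 := hkr _ hy m
    simp only [map_sub, LinearMap.sub_apply, map_smul, LinearMap.smul_apply, smul_eq_mul] at h1 h2
    linear_combination h1 + ℓ x * h2

/-- A Gram matrix of linearly independent vectors is invertible. -/
lemma det_gram_ne_zero (b : LinearMap.BilinForm ℝ W) (hb : ∀ x, x ≠ 0 → 0 < b x x)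
    (e : Fin d → W) (he : LinearIndependent ℝ e) (G : Matrix (Fin d) (Fin d) ℝ)
    (hG : ∀ i j, G i j = b (e i) (e j)) : G.det ≠ 0 := by
  intro h
  obtain ⟨c, hc0, hc⟩ := Matrix.exists_mulVec_eq_zero_iff.2 h
  -- A null vector `c` of the Gram matrix gives a combination of the `e i` of length zero.
  have h1 : ∑ i, c i • e i = 0 := by
    by_contra hne
    refine (hb _ hne).ne' ?_
    have h2 : ∀ i, ∑ j, G i j * c j = 0 := fun i => congrFun hc i
    simp only [map_sum, LinearMap.sum_apply, map_smul, LinearMap.smul_apply, smul_eq_mul,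
      Finset.mul_sum]
    rw [Finset.sum_comm]
    refine Finset.sum_eq_zero fun i _ => ?_
    rw [← mul_zero (c i), ← h2 i, Finset.mul_sum]
    refine Finset.sum_congr rfl fun j _ => ?_
    rw [hG]
    ring
  exact hc0 (funext (Fintype.linearIndependent_iff.1 he c h1))

end LinearAlgebra

/-! ### Second derivatives of compositions -/

section SecondDerivatives

variable {X Y Z : Type*} [NormedAddCommGroup X] [NormedSpace ℝ X] [NormedAddCommGroup Y]
  [NormedSpace ℝ Y] [NormedAddCommGroup Z] [NormedSpace ℝ Z]

lemma hasFDerivAt_fderiv_apply {h : X → Y} {x : X} (hh : ContDiffAt ℝ 2 h x) (w : X) :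
    HasFDerivAt (fun y => fderiv ℝ h y w) ((fderiv ℝ (fderiv ℝ h) x).flip w) x := by
  have h1 : DifferentiableAt ℝ (fderiv ℝ h) x :=
    (hh.fderiv_right (m := 1) (by norm_num)).differentiableAt one_ne_zero
  simpa using h1.hasFDerivAt.clm_apply (hasFDerivAt_const w x)

/-- Reduces a second derivative to a first one: fix the inner direction `w`, find a formula for that
derivative near `x`, and differentiate it. -/
lemma fderiv_fderiv_eq {h : X → Y} {x : X} (hh : ContDiffAt ℝ 2 h x) {w : X} {L : X →L[ℝ] Y}
    {k : X → Y} (hk : ∀ᶠ y in nhds x, fderiv ℝ h y w = k y) (hL : HasFDerivAt k L x) (v : X) :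
    fderiv ℝ (fderiv ℝ h) x v w = L v := by
  have h1 := (hasFDerivAt_fderiv_apply hh w).congr_of_eventuallyEq (hk.mono fun y hy => hy.symm)
  exact DFunLike.congr_fun (h1.unique hL) v

/-- The second derivative of a composition. -/
lemma fderiv_fderiv_comp {F : Y → Z} {φ : X → Y} {x : X} (hF : ContDiffAt ℝ 2 F (φ x))
    (hφ : ContDiffAt ℝ 2 φ x) (v w : X) :
    fderiv ℝ (fderiv ℝ (F ∘ φ)) x v w =
      fderiv ℝ (fderiv ℝ F) (φ x) (fderiv ℝ φ x v) (fderiv ℝ φ x w)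
        + fderiv ℝ F (φ x) (fderiv ℝ (fderiv ℝ φ) x v w) := by
  have hF1 : HasFDerivAt (fderiv ℝ F) (fderiv ℝ (fderiv ℝ F) (φ x)) (φ x) :=
    ((hF.fderiv_right (m := 1) (by norm_num)).differentiableAt one_ne_zero).hasFDerivAt
  have hφ1 : HasFDerivAt φ (fderiv ℝ φ x) x := (hφ.differentiableAt two_ne_zero).hasFDerivAt
  have hev : ∀ᶠ y in nhds x, fderiv ℝ (F ∘ φ) y w = fderiv ℝ F (φ y) (fderiv ℝ φ y w) := by
    filter_upwards [hφ.eventually (by simp),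
      hφ.continuousAt.eventually (hF.eventually (by simp))] with y h1 h2
    rw [fderiv_comp y (h2.differentiableAt two_ne_zero) (h1.differentiableAt two_ne_zero)]
    rfl
  rw [fderiv_fderiv_eq (hF.comp x hφ) hev
    ((hF1.comp x hφ1).clm_apply (hasFDerivAt_fderiv_apply hφ w)) v]
  simp [add_comm]

lemma fderiv_clm_comp {φ : X → Y} {x : X} (hφ : DifferentiableAt ℝ φ x) (L : Y →L[ℝ] Z) (v : X) :
    fderiv ℝ (fun y => L (φ y)) x v = L (fderiv ℝ φ x v) :=
  DFunLike.congr_fun (L.hasFDerivAt.comp x hφ.hasFDerivAt).fderiv v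

lemma fderiv_fderiv_clm_comp {φ : X → Y} {x : X} (hφ : ContDiffAt ℝ 2 φ x) (L : Y →L[ℝ] Z)
    (v w : X) :
    fderiv ℝ (fderiv ℝ fun y => L (φ y)) x v w = L (fderiv ℝ (fderiv ℝ φ) x v w) := by
  have := fderiv_fderiv_comp (F := L) L.contDiff.contDiffAt hφ v w
  rw [L.fderiv] at this
  refine this.trans ?_
  have h0 : fderiv ℝ (fderiv ℝ L) (φ x) = 0 := by
    have : fderiv ℝ L = fun _ => L := funext fun y => L.fderiv
    rw [this]
    simp
  simp [h0]

end SecondDerivatives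

/-! ### The hyperboloid model and lifts to Minkowski space -/

section Hyperbolic

variable {d m : ℕ}

/-- The hyperbolic metric at `x` as a bilinear form. -/
noncomputable def hyperbolicForm (x : E m) : LinearMap.BilinForm ℝ (E m) :=
  LinearMap.mk₂ ℝ (fun y z => inner ℝ y z - inner ℝ x y * inner ℝ x z / (1 + ‖x‖ ^ 2))
    (fun y y' z => by simp only [inner_add_left, inner_add_right]; ring)
    (fun c y z => by simp only [real_inner_smul_left, real_inner_smul_right, smul_eq_mul]; ring)
    (fun y z z' => by simp only [inner_add_right]; ring)
    (fun c y z => by simp only [real_inner_smul_right, smul_eq_mul]; ring)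

lemma hyperbolicForm_apply (x y z : E m) :
    hyperbolicForm x y z = inner ℝ y z - inner ℝ x y * inner ℝ x z / (1 + ‖x‖ ^ 2) := rfl

lemma hyperbolicForm_comm (x y z : E m) : hyperbolicForm x y z = hyperbolicForm x z y := by
  rw [hyperbolicForm_apply, hyperbolicForm_apply, real_inner_comm]
  ring

/-- By Cauchy–Schwarz the subtracted term is at most `‖x‖² ‖y‖² / (1 + ‖x‖²) < ‖y‖²`. -/
lemma hyperbolicForm_pos (x : E m) {y : E m} (hy : y ≠ 0) : 0 < hyperbolicForm x y y := by
  have h1 : inner ℝ x y * inner ℝ x y ≤ ‖x‖ ^ 2 * ‖y‖ ^ 2 := by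
    have := real_inner_mul_inner_self_le x y
    rwa [real_inner_self_eq_norm_sq, real_inner_self_eq_norm_sq] at this
  have h2 : 0 < ‖y‖ ^ 2 := by positivity
  rw [hyperbolicForm_apply, real_inner_self_eq_norm_sq, sub_pos, div_lt_iff₀ (by positivity)]
  linarith

lemma hyperbolicForm_nonneg (x y : E m) : 0 ≤ hyperbolicForm x y y := by
  rcases eq_or_ne y 0 with rfl | hy
  · simp
  · exact (hyperbolicForm_pos x hy).le

lemma form_hyperbolicMetric (x y z : E m) :
    form (hyperbolicMetric x) y z = hyperbolicForm x y z := by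
  have h1 : ∀ a b : E m, inner ℝ a b = ∑ i, a i * b i := fun a b => by
    simp [PiLp.inner_apply, mul_comm]
  have h2 : ‖x‖ ^ 2 = ∑ k, x k ^ 2 := by simp [EuclideanSpace.norm_sq_eq]
  simp only [form, hyperbolicMetric, hyperbolicForm_apply, h1, h2, sub_mul, Finset.sum_sub_distrib]
  congr 1
  · simp
  · rw [Finset.sum_mul_sum, Finset.sum_div]
    refine Finset.sum_congr rfl fun i _ => ?_
    rw [Finset.sum_div]
    refine Finset.sum_congr rfl fun j _ => ?_
    ring

/-- The coordinates of the lift of `φ` to the hyperboloid in Minkowski space. -/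
noncomputable def hyperboloidLift (φ : E d → E m) : Option (Fin m) → E d → ℝ
  | none => fun u => √(1 + ‖φ u‖ ^ 2)
  | some a => fun u => φ u a

/-- The signs of the Minkowski metric. -/
def minkowskiSign : Option (Fin m) → ℝ
  | none => -1
  | some _ => 1

variable {φ : E d → E m} {V : Set (E d)} {u : E d}

lemma contDiffOn_hyperboloidLift (hφ : ContDiffOn ℝ 2 φ V) (a : Option (Fin m)) :
    ContDiffOn ℝ 2 (hyperboloidLift φ a) V := by
  cases a with
  | none => exact (contDiffOn_const.add (hφ.norm_sq ℝ)).sqrt fun x _ => by positivity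
  | some a => exact (EuclideanSpace.proj (𝕜 := ℝ) a).contDiff.comp_contDiffOn hφ

lemma fderiv_hyperboloidLift_some (hφ : DifferentiableAt ℝ φ u) (a : Fin m) (v : E d) :
    fderiv ℝ (hyperboloidLift φ (some a)) u v = fderiv ℝ φ u v a :=
  fderiv_clm_comp hφ (EuclideanSpace.proj a) v

lemma fderiv_fderiv_hyperboloidLift_some (hφ : ContDiffAt ℝ 2 φ u) (a : Fin m) (v w : E d) :
    fderiv ℝ (fderiv ℝ (hyperboloidLift φ (some a))) u v w = fderiv ℝ (fderiv ℝ φ) u v w a :=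
  fderiv_fderiv_clm_comp hφ (EuclideanSpace.proj a) v w

lemma fderiv_hyperboloidLift_none (hφ : DifferentiableAt ℝ φ u) (v : E d) :
    fderiv ℝ (hyperboloidLift φ none) u v = inner ℝ (φ u) (fderiv ℝ φ u v) / √(1 + ‖φ u‖ ^ 2) := by
  have h := ((hφ.hasFDerivAt.norm_sq).const_add 1).sqrt (by positivity)
  refine (DFunLike.congr_fun h.fderiv v).trans ?_
  simp
  ring

lemma fderiv_fderiv_hyperboloidLift_none (hφ : ContDiffAt ℝ 2 φ u) (v w : E d) :
    fderiv ℝ (fderiv ℝ (hyperboloidLift φ none)) u v w =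
      (hyperbolicForm (φ u) (fderiv ℝ φ u v) (fderiv ℝ φ u w)
        + inner ℝ (φ u) (fderiv ℝ (fderiv ℝ φ) u v w)) / √(1 + ‖φ u‖ ^ 2) := by
  have hd : DifferentiableAt ℝ φ u := hφ.differentiableAt two_ne_zero
  have hc : ContDiffAt ℝ 2 (hyperboloidLift φ none) u :=
    (contDiffAt_const.add (hφ.norm_sq ℝ)).sqrt (by positivity)
  have hev : ∀ᶠ y in nhds u, fderiv ℝ (hyperboloidLift φ none) y w =
      inner ℝ (φ y) (fderiv ℝ φ y w) * (hyperboloidLift φ none y)⁻¹ := by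
    filter_upwards [hφ.eventually (by simp)] with y hy
    exact fderiv_hyperboloidLift_none (hy.differentiableAt two_ne_zero) w
  have hs : (0 : ℝ) < 1 + ‖φ u‖ ^ 2 := by positivity
  have h0 : hyperboloidLift φ none u ≠ 0 := (Real.sqrt_pos.2 hs).ne'
  have h1 := (hd.hasFDerivAt.inner ℝ (hasFDerivAt_fderiv_apply hφ w)).mul
    ((hasDerivAt_inv h0).comp_hasFDerivAt u (hc.differentiableAt two_ne_zero).hasFDerivAt)
  rw [fderiv_fderiv_eq hc hev h1 v]
  simp only [add_apply, smul_apply, smul_eq_mul, fderiv_hyperboloidLift_none hd,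
    hyperbolicForm_apply, Function.comp_apply]
  simp only [hyperboloidLift, Real.sq_sqrt hs.le]
  simp
  field_simp
  ring

end Hyperbolic

/-! ### Minkowski products of the derivatives of the lift -/

section Hyperbolic

variable {d m : ℕ} {φ : E d → E m} {V : Set (E d)} {u : E d}

/-- The covariant acceleration of the parametrization `φ` with respect to the hyperbolic metric. -/
noncomputable def covariantHessian (φ : E d → E m) (u v w : E d) : E m :=
  fderiv ℝ (fderiv ℝ φ) u v w
    - hyperbolicForm (φ u) (fderiv ℝ φ u v) (fderiv ℝ φ u w) • φ u

lemma inner_eq_sum (y z : E m) : inner ℝ y z = ∑ i, y i * z i := by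
  simp [PiLp.inner_apply, mul_comm]

lemma sum_minkowskiSign_fderiv_mul_fderiv (hφ : DifferentiableAt ℝ φ u) (v w : E d) :
    ∑ a, minkowskiSign a * (fderiv ℝ (hyperboloidLift φ a) u v * fderiv ℝ (hyperboloidLift φ a) u w)
      = hyperbolicForm (φ u) (fderiv ℝ φ u v) (fderiv ℝ φ u w) := by
  have hs : (0 : ℝ) < 1 + ‖φ u‖ ^ 2 := by positivity
  rw [Fintype.sum_option]
  simp only [minkowskiSign, fderiv_hyperboloidLift_some hφ, fderiv_hyperboloidLift_none hφ,
    hyperbolicForm_apply, one_mul, ← inner_eq_sum]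
  rw [div_mul_div_comm, Real.mul_self_sqrt hs.le]
  ring

/-- The component of `D²Φ` along the position vector `Φ` is Minkowski orthogonal to the hyperboloid,
so it disappears against `DΦ`; only the lift of `covariantHessian` is seen. -/
lemma sum_minkowskiSign_fderiv_fderiv_mul_fderiv (hφ : ContDiffAt ℝ 2 φ u) (v w z : E d) :
    ∑ a, minkowskiSign a * (fderiv ℝ (fderiv ℝ (hyperboloidLift φ a)) u v w
        * fderiv ℝ (hyperboloidLift φ a) u z)
      = hyperbolicForm (φ u) (covariantHessian φ u v w) (fderiv ℝ φ u z) := by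
  have hs : (0 : ℝ) < 1 + ‖φ u‖ ^ 2 := by positivity
  have hd : DifferentiableAt ℝ φ u := hφ.differentiableAt two_ne_zero
  rw [Fintype.sum_option]
  simp only [minkowskiSign, fderiv_hyperboloidLift_some hd, fderiv_hyperboloidLift_none hd,
    fderiv_fderiv_hyperboloidLift_some hφ, fderiv_fderiv_hyperboloidLift_none hφ,
    one_mul, ← inner_eq_sum]
  rw [div_mul_div_comm, Real.mul_self_sqrt hs.le, covariantHessian]
  generalize hyperbolicForm (φ u) (fderiv ℝ φ u v) (fderiv ℝ φ u w) = α
  simp only [hyperbolicForm_apply, inner_sub_left, inner_sub_right, real_inner_smul_left,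
    real_inner_smul_right, real_inner_self_eq_norm_sq]
  field_simp
  ring

/-- Here the components along `Φ` do contribute, with a minus sign because `⟨Φ, Φ⟩ = -1`. This
product is the source of the ambient curvature `-1`. -/
lemma sum_minkowskiSign_fderiv_fderiv_mul (hφ : ContDiffAt ℝ 2 φ u) (v w v' w' : E d) :
    ∑ a, minkowskiSign a * (fderiv ℝ (fderiv ℝ (hyperboloidLift φ a)) u v w
        * fderiv ℝ (fderiv ℝ (hyperboloidLift φ a)) u v' w')
      = hyperbolicForm (φ u) (covariantHessian φ u v w) (covariantHessian φ u v' w')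
        - hyperbolicForm (φ u) (fderiv ℝ φ u v) (fderiv ℝ φ u w)
          * hyperbolicForm (φ u) (fderiv ℝ φ u v') (fderiv ℝ φ u w') := by
  have hs : (0 : ℝ) < 1 + ‖φ u‖ ^ 2 := by positivity
  rw [Fintype.sum_option]
  simp only [minkowskiSign, fderiv_fderiv_hyperboloidLift_some hφ,
    fderiv_fderiv_hyperboloidLift_none hφ, one_mul, ← inner_eq_sum]
  rw [div_mul_div_comm, Real.mul_self_sqrt hs.le, covariantHessian, covariantHessian]
  generalize hyperbolicForm (φ u) (fderiv ℝ φ u v) (fderiv ℝ φ u w) = α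
  generalize hyperbolicForm (φ u) (fderiv ℝ φ u v') (fderiv ℝ φ u w') = β
  simp only [hyperbolicForm_apply, inner_sub_left, inner_sub_right, real_inner_smul_left,
    real_inner_smul_right, real_inner_self_eq_norm_sq, real_inner_comm (φ u)]
  field_simp
  ring

lemma covariantHessian_comm (hφ : ContDiffAt ℝ 2 φ u) (v w : E d) :
    covariantHessian φ u v w = covariantHessian φ u w v := by
  rw [covariantHessian, covariantHessian, hyperbolicForm_comm,
    hφ.isSymmSndFDerivAt (by simp) v w]

end Hyperbolic

/-! ### Gauss equation for hypersurfaces of hyperbolic space -/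

section Hypersurface

variable {n : ℕ} {φ : E n → E (n + 1)} {V : Set (E n)} {u : E n}

lemma inducedMetric_hyperbolicMetric (φ : E n → E (n + 1)) (u : E n) (i j : Fin n) :
    inducedMetric hyperbolicMetric φ u i j = hyperbolicForm (φ u)
      (fderiv ℝ φ u (EuclideanSpace.single i 1)) (fderiv ℝ φ u (EuclideanSpace.single j 1)) :=
  form_hyperbolicMetric _ _ _

lemma inducedMetric_eq_sum (hφ : DifferentiableAt ℝ φ u) (i j : Fin n) :
    inducedMetric hyperbolicMetric φ u i j = ∑ a, minkowskiSign a *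
      (pd i (hyperboloidLift φ a) u * pd j (hyperboloidLift φ a) u) := by
  rw [inducedMetric_hyperbolicMetric, ← sum_minkowskiSign_fderiv_mul_fderiv hφ]
  rfl

lemma form_inducedMetric (φ : E n → E (n + 1)) (u v w : E n) :
    form (inducedMetric hyperbolicMetric φ u) v w
      = hyperbolicForm (φ u) (fderiv ℝ φ u v) (fderiv ℝ φ u w) := by
  rw [map_eq_sum_single (fderiv ℝ φ u) v, map_eq_sum_single (fderiv ℝ φ u) w]
  simp only [form, inducedMetric_hyperbolicMetric, map_sum, LinearMap.sum_apply, map_smul,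
    LinearMap.smul_apply, smul_eq_mul, Finset.mul_sum]
  rw [Finset.sum_comm]
  refine Finset.sum_congr rfl fun i _ => Finset.sum_congr rfl fun j _ => ?_
  ring

lemma linearIndependent_fderiv_single (hinj : Function.Injective (fderiv ℝ φ u)) :
    LinearIndependent ℝ fun i => fderiv ℝ φ u (EuclideanSpace.single i 1) := by
  have h := (EuclideanSpace.basisFun (Fin n) ℝ).toBasis.linearIndependent.map'
    (fderiv ℝ φ u : E n →ₗ[ℝ] E (n + 1)) (LinearMap.ker_eq_bot.2 hinj)
  simpa [Function.comp_def] using h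

lemma det_inducedMetric_ne_zero (hinj : Function.Injective (fderiv ℝ φ u)) :
    (inducedMetric hyperbolicMetric φ u).det ≠ 0 :=
  det_gram_ne_zero (hyperbolicForm (φ u)) (fun _ hx => hyperbolicForm_pos _ hx) _
    (linearIndependent_fderiv_single hinj) _ (inducedMetric_hyperbolicMetric φ u)

/-- The curvature tensor of a hypersurface of hyperbolic space. -/
noncomputable def hypersurfaceCurvature (φ : E n → E (n + 1)) :
    E n → Fin n → Fin n → Fin n → Fin n → ℝ :=
  gaussCurvature minkowskiSign (hyperboloidLift φ) (inducedMetric hyperbolicMetric φ)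

lemma isCurvatureTensor_hypersurfaceCurvature (hV : IsOpen V) (hφ : ContDiffOn ℝ 2 φ V)
    (hinj : ∀ u ∈ V, Function.Injective (fderiv ℝ φ u)) :
    IsCurvatureTensor (inducedMetric hyperbolicMetric φ) V (hypersurfaceCurvature φ) :=
  isCurvatureTensor_gaussCurvature hV (contDiffOn_hyperboloidLift hφ)
    (fun _ hu => inducedMetric_eq_sum
      ((hφ.contDiffAt (hV.mem_nhds hu)).differentiableAt two_ne_zero))
    fun u hu => det_inducedMetric_ne_zero (hinj u hu)

/-- The Gauss equation for a hypersurface of hyperbolic space with conormal `ℓ`. -/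
lemma exists_contract_hypersurfaceCurvature_eq (hV : IsOpen V) (hφ : ContDiffOn ℝ 2 φ V)
    (hu : u ∈ V) (hinj : Function.Injective (fderiv ℝ φ u)) (ℓ : E (n + 1) →ₗ[ℝ] ℝ) (hℓ : ℓ ≠ 0)
    (hℓφ : ∀ v, ℓ (fderiv ℝ φ u v) = 0) :
    ∃ s : ℝ, 0 ≤ s ∧ ∀ v w, contract (hypersurfaceCurvature φ u) v w =
      s * (ℓ (covariantHessian φ u v v) * ℓ (covariantHessian φ u w w)
          - ℓ (covariantHessian φ u v w) ^ 2)
        - (form (inducedMetric hyperbolicMetric φ u) v v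
            * form (inducedMetric hyperbolicMetric φ u) w w
          - form (inducedMetric hyperbolicMetric φ u) v w ^ 2) := by
  have hc : ContDiffAt ℝ 2 φ u := hφ.contDiffAt (hV.mem_nhds hu)
  -- One inclusion is the tangency of `Dφ` to `ker ℓ`; both spaces have dimension `n`.
  have hrange : LinearMap.range (fderiv ℝ φ u : E n →ₗ[ℝ] E (n + 1)) = LinearMap.ker ℓ := by
    refine Submodule.eq_of_le_of_finrank_eq ?_ ?_
    · rintro _ ⟨v, rfl⟩
      exact hℓφ v
    · have h1 := Module.Dual.finrank_ker_add_one_of_ne_zero hℓ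
      have h2 := LinearMap.finrank_range_of_inj (f := (fderiv ℝ φ u : E n →ₗ[ℝ] E (n + 1))) hinj
      simp only [finrank_euclideanSpace, Fintype.card_fin] at h1 h2
      omega
  have hker : LinearMap.ker ℓ ≤ Submodule.span ℝ
      (range fun i => fderiv ℝ φ u (EuclideanSpace.single i 1)) := by
    rw [← hrange]
    rintro _ ⟨v, rfl⟩
    change fderiv ℝ φ u v ∈ _
    rw [map_eq_sum_single]
    exact Submodule.sum_mem _ fun i _ =>
      Submodule.smul_mem _ _ (Submodule.subset_span (mem_range_self i))
  obtain ⟨s, hs, hQ⟩ := exists_sub_sum_gram_inv_eq (hyperbolicForm (φ u))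
    (hyperbolicForm_nonneg _) (hyperbolicForm_comm _) _ _ (inducedMetric_hyperbolicMetric φ u)
    (det_inducedMetric_ne_zero hinj) ℓ hℓ hker
  refine ⟨s, hs, fun v w => ?_⟩
  have hΓ : ∀ (v w : E n) (p : Fin n),
      ∑ i, ∑ j, christoffel (inducedMetric hyperbolicMetric φ) i j p u * v i * w j
        = hyperbolicForm (φ u) (covariantHessian φ u v w)
          (fderiv ℝ φ u (EuclideanSpace.single p 1)) := fun v w p => by
    rw [sum_christoffel_mul hV (contDiffOn_hyperboloidLift hφ) (fun _ hu => inducedMetric_eq_sum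
      ((hφ.contDiffAt (hV.mem_nhds hu)).differentiableAt two_ne_zero)) hu,
      ← sum_minkowskiSign_fderiv_fderiv_mul_fderiv hc]
    rfl
  rw [hypersurfaceCurvature, contract_gaussCurvature hV (contDiffOn_hyperboloidLift hφ) hu]
  simp only [hΓ, mul_sub, Finset.sum_sub_distrib, sum_minkowskiSign_fderiv_fderiv_mul hc,
    form_inducedMetric]
  have h1 := hQ (covariantHessian φ u w w) (covariantHessian φ u v v)
  have h2 := hQ (covariantHessian φ u v w) (covariantHessian φ u w v)
  rw [← covariantHessian_comm hc v w] at h2 ⊢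
  rw [hyperbolicForm_comm (φ u) (fderiv ℝ φ u w) (fderiv ℝ φ u v)]
  linear_combination h1 - h2

/-- A hypersurface of hyperbolic space with semidefinite second fundamental form has sectional
curvatures at least `-1`. -/
lemma neg_one_le_sectionalCurvature (hV : IsOpen V) (hφ : ContDiffOn ℝ 2 φ V)
    (hu : u ∈ V) (hinj : Function.Injective (fderiv ℝ φ u)) (ℓ : E (n + 1) →ₗ[ℝ] ℝ) (hℓ : ℓ ≠ 0)
    (hℓφ : ∀ v, ℓ (fderiv ℝ φ u v) = 0)
    (hsemi : ∀ v w, ℓ (covariantHessian φ u v w) ^ 2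
      ≤ ℓ (covariantHessian φ u v v) * ℓ (covariantHessian φ u w w))
    {v w : E n} (hvw : LinearIndependent ℝ ![v, w]) :
    -1 ≤ sectionalCurvature (inducedMetric hyperbolicMetric φ u) (hypersurfaceCurvature φ u) v w := by
  obtain ⟨s, hs, hK⟩ := exists_contract_hypersurfaceCurvature_eq hV hφ hu hinj ℓ hℓ hℓφ
  have hpos : 0 < form (inducedMetric hyperbolicMetric φ u) v v
      * form (inducedMetric hyperbolicMetric φ u) w w
      - form (inducedMetric hyperbolicMetric φ u) v w ^ 2 := by
    simp only [form_inducedMetric]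
    set y := fderiv ℝ φ u v
    set z := fderiv ℝ φ u w
    have hv : v ≠ 0 := hvw.ne_zero 0
    have hy : y ≠ 0 := fun h => hv (hinj (h.trans (map_zero _).symm))
    have hyy := hyperbolicForm_pos (φ u) hy
    set α := hyperbolicForm (φ u) y y
    set β := hyperbolicForm (φ u) y z
    -- This is the Gram–Schmidt vector: its square length is `α` times the Gram determinant of `y,
    -- z`.
    have hne : α • z - β • y ≠ 0 := fun h => by
      have h3 : fderiv ℝ φ u (α • w - β • v) = 0 := by simpa [y, z] using h
      have h4 : (-β) • v + α • w = 0 := by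
        rw [← hinj (h3.trans (map_zero _).symm)]
        module
      exact hyy.ne' (LinearIndependent.pair_iff.1 hvw _ _ h4).2
    have h5 := hyperbolicForm_pos (φ u) hne
    simp only [map_sub, LinearMap.sub_apply, map_smul, LinearMap.smul_apply, smul_eq_mul,
      hyperbolicForm_comm (φ u) z y] at h5
    change 0 < α * (α * _ - β * β) - β * (α * β - β * α) at h5
    refine (mul_pos_iff_of_pos_left hyy).1 ?_
    linarith
  rw [sectionalCurvature, le_div_iff₀ hpos]
  change _ ≤ contract (hypersurfaceCurvature φ u) v w
  rw [hK]
  have := mul_nonneg hs (sub_nonneg.2 (hsemi v w))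
  linarith

end Hypersurface

/-! ### Parametrization of regular level sets -/

section LevelSet

/-- A regular level set of a `C²` function has local parametrizations. -/
lemma exists_isLocalParam_levelSet {n : ℕ} {O : Set (E (n + 1))} (hO : IsOpen O)
    {F : E (n + 1) → ℝ} (hF : ContDiffOn ℝ 2 F O) {q : E (n + 1)} (hq : q ∈ O) (hFq : F q = 0)
    (hreg : fderiv ℝ F q ≠ 0) :
    ∃ (V : Set (E n)) (φ : E n → E (n + 1)),
      IsLocalParam {x | x ∈ O ∧ F x = 0} V φ ∧ q ∈ φ '' V := by
  set L := fderiv ℝ F q with hL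
  have hLℓ : (L : E (n + 1) →ₗ[ℝ] ℝ) ≠ 0 := fun h => hreg (by ext x; exact DFunLike.congr_fun h x)
  have hrank : Module.finrank ℝ (LinearMap.ker (L : E (n + 1) →ₗ[ℝ] ℝ)) = Module.finrank ℝ (E n) := by
    have := Module.Dual.finrank_ker_add_one_of_ne_zero hLℓ
    simp only [finrank_euclideanSpace, Fintype.card_fin] at this ⊢
    omega
  let κ := LinearEquiv.ofFinrankEq _ _ hrank
  obtain ⟨P, hP⟩ := LinearMap.exists_leftInverse_of_injective
    (LinearMap.ker (L : E (n + 1) →ₗ[ℝ] ℝ)).subtype (Submodule.ker_subtype _)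
  -- `P` projects onto `ker L`, so `A` is an isomorphism. It is the derivative at `q` of the map `Ψ
  -- = (P', F)`, which therefore straightens the level set near `q` to the slice `E n × {0}`.
  let A : E (n + 1) →ₗ[ℝ] E n × ℝ := (κ.toLinearMap ∘ₗ P).prod L
  have hAinj : Function.Injective A := by
    rw [← LinearMap.ker_eq_bot, LinearMap.ker_eq_bot']
    intro x hx
    have h1 : κ (P x) = 0 := congrArg Prod.fst hx
    have h2 : L x = 0 := congrArg Prod.snd hx
    have h3 : P x = ⟨x, h2⟩ := DFunLike.congr_fun hP ⟨x, h2⟩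
    rw [h3] at h1
    exact congrArg Subtype.val (κ.map_eq_zero_iff.1 h1)
  have hAdim : Module.finrank ℝ (E (n + 1)) = Module.finrank ℝ (E n × ℝ) := by simp
  let A' : E (n + 1) ≃L[ℝ] E n × ℝ :=
    (LinearEquiv.ofInjectiveOfFinrankEq A hAinj hAdim).toContinuousLinearEquiv
  let P' : E (n + 1) →L[ℝ] E n := LinearMap.toContinuousLinearMap (κ.toLinearMap ∘ₗ P)
  let Ψ : E (n + 1) → E n × ℝ := fun x => (P' x, F x)
  have hΨ : ContDiffOn ℝ 2 Ψ O := P'.contDiff.contDiffOn.prodMk hF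
  have hFd : HasFDerivAt F L q :=
    ((hF.contDiffAt (hO.mem_nhds hq)).differentiableAt two_ne_zero).hasFDerivAt
  have hΨd : HasFDerivAt Ψ (A' : E (n + 1) →L[ℝ] E n × ℝ) q := P'.hasFDerivAt.prodMk hFd
  have hΨq := hΨ.contDiffAt (hO.mem_nhds hq)
  let H := hΨq.toOpenPartialHomeomorph Ψ hΨd two_ne_zero
  have hHq : q ∈ H.source := hΨq.mem_toOpenPartialHomeomorph_source hΨd two_ne_zero
  have hinv : ContDiffAt ℝ 2 H.symm (Ψ q) := hΨq.to_localInverse hΨd two_ne_zero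
  -- `C²` regularity of the inverse at the single point `Ψ q` must be spread to a neighbourhood, on
  -- which it also stays inside `O`.
  have hgood : ∀ᶠ z in nhds (Ψ q), ContDiffAt ℝ 2 H.symm z ∧ H.symm z ∈ O ∧ z ∈ H.target := by
    refine (hinv.eventually (by simp)).and ((H.continuousAt_symm (H.map_source hHq)).eventually
      ?_ |>.and (H.open_target.mem_nhds (H.map_source hHq)))
    rw [H.left_inv hHq]
    exact hO.mem_nhds hq
  obtain ⟨T, hTsub, hTo, hTq⟩ := eventually_nhds_iff.1 hgood
  let j : E n → E n × ℝ := fun u => (u, 0)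
  have hj : ContDiff ℝ 2 j := contDiff_id.prodMk contDiff_const
  have hjd : ∀ u, HasFDerivAt j (ContinuousLinearMap.inl ℝ (E n) ℝ) u := fun u =>
    (ContinuousLinearMap.inl ℝ (E n) ℝ).hasFDerivAt
  have hΨj : ∀ u ∈ j ⁻¹' T, Ψ (H.symm (j u)) = j u := fun u hu => H.right_inv (hTsub _ hu).2.2
  have hVo : IsOpen (j ⁻¹' T) := hTo.preimage hj.continuous
  have hφ : ∀ u ∈ j ⁻¹' T, ContDiffAt ℝ 2 (fun u => H.symm (j u)) u := fun u hu =>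
    (hTsub _ hu).1.comp u hj.contDiffAt
  have hqj : j (P' q) = Ψ q := Prod.ext rfl hFq.symm
  refine ⟨j ⁻¹' T, fun u => H.symm (j u), ⟨hVo, fun u hu => (hφ u hu).contDiffWithinAt,
    fun u hu => ?_, fun u hu u' hu' h => ?_, fun V' hV' hV'o => ?_⟩, P' q, ?_, ?_⟩
  · have hx : H.symm (j u) ∈ O := (hTsub _ hu).2.1
    have h1 := ((hΨ.contDiffAt (hO.mem_nhds hx)).differentiableAt two_ne_zero).hasFDerivAt.comp u
      ((hφ u hu).differentiableAt two_ne_zero).hasFDerivAt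
    have h2 : Ψ ∘ (fun u => H.symm (j u)) =ᶠ[nhds u] j := by
      filter_upwards [hVo.mem_nhds hu] with y hy using hΨj y hy
    have h3 := (h1.congr_of_eventuallyEq h2.symm).unique (hjd u)
    intro a b hab
    have h4 := (DFunLike.congr_fun h3 a).symm.trans
      ((congrArg (fderiv ℝ Ψ (H.symm (j u))) hab).trans (DFunLike.congr_fun h3 b))
    exact congrArg Prod.fst h4
  · have h1 := congrArg Ψ h
    simp only [hΨj u hu, hΨj u' hu'] at h1
    exact congrArg Prod.fst h1
  · refine ⟨H.source ∩ H ⁻¹' (T ∩ Prod.fst ⁻¹' V'), H.isOpen_inter_preimage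
      (hTo.inter (hV'o.preimage continuous_fst)), ?_⟩
    ext x
    constructor
    · rintro ⟨u, hu, rfl⟩
      have huT := hV' hu
      have h1 : Ψ (H.symm (j u)) = j u := hΨj u huT
      refine ⟨⟨(hTsub _ huT).2.1, congrArg Prod.snd h1⟩, H.map_target (hTsub _ huT).2.2, ?_⟩
      have h2 : j u ∈ T ∩ Prod.fst ⁻¹' V' := ⟨huT, hu⟩
      rw [← h1] at h2
      exact h2
    · rintro ⟨⟨-, hx0⟩, hxs, hxT, hxV⟩
      have h1 : j (P' x) = H x := Prod.ext rfl hx0.symm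
      refine ⟨P' x, hxV, ?_⟩
      change H.symm (j (P' x)) = x
      rw [h1, H.left_inv hxs]
  · change j (P' q) ∈ T
    rwa [hqj]
  · change H.symm (j (P' q)) = q
    rw [hqj]
    exact H.left_inv hHq

/-- The image of a local parametrization lies in the hypersurface. -/
lemma IsLocalParam.mapsTo {n : ℕ} {M : Set (E (n + 1))} {V : Set (E n)} {φ : E n → E (n + 1)}
    (h : IsLocalParam M V φ) : MapsTo φ V M := by
  obtain ⟨W, -, hW⟩ := h.image_open V Subset.rfl h.isOpen
  intro u hu
  exact (hW ▸ mem_image_of_mem φ hu : φ u ∈ M ∩ W).1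

end LevelSet

/-! ### The fold as a level set -/

section Fold

variable {n : ℕ} {U : Set (E n)} {f : E n → ℝ} {lam : ℝ}

/-- The projection `ℝⁿ⁺¹ → ℝⁿ` as a continuous linear map. -/
noncomputable def projCLM (n : ℕ) : E (n + 1) →L[ℝ] E n :=
  LinearMap.toContinuousLinearMap
    { toFun := proj
      map_add' := fun x y => by ext; simp [proj]
      map_smul' := fun c x => by ext; simp [proj] }

lemma projCLM_apply (x : E (n + 1)) : projCLM n x = proj x := rfl

/-- The last coordinate as a continuous linear map. -/
noncomputable abbrev lastCLM (n : ℕ) : E (n + 1) →L[ℝ] ℝ := EuclideanSpace.proj (Fin.last n)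

/-- The function whose zero set over `U` is the fold. -/
noncomputable def foldFunction (f : E n → ℝ) (lam : ℝ) (q : E (n + 1)) : ℝ :=
  lastCLM n q ^ 2 - lam ^ 2 * f (projCLM n q)

lemma fold_eq : fold U f lam = {q | q ∈ projCLM n ⁻¹' U ∧ foldFunction f lam q = 0} := by
  ext q
  simp only [fold, foldFunction, mem_ofPred_eq, sub_eq_zero]
  rfl

lemma contDiffOn_foldFunction (hf : ContDiffOn ℝ 2 f U) :
    ContDiffOn ℝ 2 (foldFunction f lam) (projCLM n ⁻¹' U) :=
  ((lastCLM n).contDiff.pow 2).contDiffOn.sub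
    (contDiffOn_const.mul (hf.comp (projCLM n).contDiff.contDiffOn fun _ h => h))

lemma hasFDerivAt_foldFunction {q : E (n + 1)} (hf : DifferentiableAt ℝ f (projCLM n q)) :
    HasFDerivAt (foldFunction f lam) ((2 * lastCLM n q) • lastCLM n
      - lam ^ 2 • (fderiv ℝ f (projCLM n q)).comp (projCLM n)) q := by
  have h := ((lastCLM n).hasFDerivAt (x := q)).pow 2 |>.sub
    ((hf.hasFDerivAt.comp q (projCLM n).hasFDerivAt).const_mul (lam ^ 2))
  refine h.congr_fderiv ?_
  simp

lemma fderiv_fderiv_foldFunction {q : E (n + 1)} (hf : ContDiffAt ℝ 2 f (projCLM n q))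
    (y z : E (n + 1)) :
    fderiv ℝ (fderiv ℝ (foldFunction f lam)) q y z = 2 * lastCLM n y * lastCLM n z
      - lam ^ 2 * fderiv ℝ (fderiv ℝ f) (projCLM n q) (projCLM n y) (projCLM n z) := by
  have hc : ContDiffAt ℝ 2 (foldFunction f lam) q :=
    ((lastCLM n).contDiff.contDiffAt.pow 2).sub
      (contDiffAt_const.mul (hf.comp q (projCLM n).contDiff.contDiffAt))
  have hev : ∀ᶠ x in nhds q, fderiv ℝ (foldFunction f lam) x z =
      2 * lastCLM n z * lastCLM n x - lam ^ 2 * fderiv ℝ f (projCLM n x) (projCLM n z) := by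
    filter_upwards [(projCLM n).continuous.continuousAt.eventually (hf.eventually (by simp))]
      with x hx
    rw [(hasFDerivAt_foldFunction (hx.differentiableAt two_ne_zero)).fderiv]
    simp
    ring
  have hd := (((lastCLM n).hasFDerivAt (x := q)).const_mul (2 * lastCLM n z)).sub
    (((hasFDerivAt_fderiv_apply hf (projCLM n z)).comp q (projCLM n).hasFDerivAt).const_mul
      (lam ^ 2))
  rw [fderiv_fderiv_eq hc hev hd y]
  simp
  ring

/-- The vertical derivative is `2 xₙ₊₁`. Where it vanishes on the fold, `lam ≠ 0` forces `f = 0`,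
and the horizontal derivative `-lam² Df` is nonzero by regularity. -/
lemma fderiv_foldFunction_ne_zero (hlam : lam ≠ 0) {q : E (n + 1)}
    (hf : DifferentiableAt ℝ f (projCLM n q)) (hreg : f (projCLM n q) = 0 → fderiv ℝ f (projCLM n q) ≠ 0)
    (hq : foldFunction f lam q = 0) : fderiv ℝ (foldFunction f lam) q ≠ 0 := by
  rw [(hasFDerivAt_foldFunction hf).fderiv]
  intro h
  have hlast : projCLM n (EuclideanSpace.single (Fin.last n) (1 : ℝ)) = 0 := by
    ext i
    simp [projCLM_apply, proj, Fin.castSucc_ne_last]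
  have h1 := DFunLike.congr_fun h (EuclideanSpace.single (Fin.last n) (1 : ℝ))
  have h2 : q (Fin.last n) = 0 := by
    simpa [hlast] using h1
  have h3 : f (projCLM n q) = 0 := by
    simpa [foldFunction, h2, hlam] using hq
  refine hreg h3 ?_
  ext y
  have h4 := DFunLike.congr_fun h (WithLp.toLp 2 (Fin.snoc (fun i => y i) 0 : Fin (n + 1) → ℝ))
  have h5 : projCLM n (WithLp.toLp 2 (Fin.snoc (fun i => y i) 0 : Fin (n + 1) → ℝ)) = y := by
    ext i
    simp [projCLM_apply, proj]
  simpa [h2, h5, hlam] using h4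

end Fold

/-! ### Convexity of the fold -/

section Fold

variable {n : ℕ} {U : Set (E n)} {f : E n → ℝ} {lam : ℝ}

/-- The Hessian of the fold function in hyperbolic space, evaluated on tangent vectors of its zero
set. -/
noncomputable def foldHessian (f : E n → ℝ) (lam : ℝ) (q : E (n + 1)) :
    LinearMap.BilinForm ℝ (E (n + 1)) :=
  (fderiv ℝ (fderiv ℝ (foldFunction f lam)) q).toLinearMap₁₂
    + fderiv ℝ (foldFunction f lam) q q • hyperbolicForm q

lemma foldHessian_apply (q y z : E (n + 1)) :
    foldHessian f lam q y z = fderiv ℝ (fderiv ℝ (foldFunction f lam)) q y z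
      + fderiv ℝ (foldFunction f lam) q q * hyperbolicForm q y z := rfl

lemma foldHessian_comm {q : E (n + 1)} (hf : ContDiffAt ℝ 2 f (projCLM n q)) (y z : E (n + 1)) :
    foldHessian f lam q y z = foldHessian f lam q z y := by
  rw [foldHessian_apply, foldHessian_apply, hyperbolicForm_comm, fderiv_fderiv_foldFunction hf,
    fderiv_fderiv_foldFunction hf, hf.isSymmSndFDerivAt (by simp) (projCLM n y) (projCLM n z)]
  ring

lemma foldHessian_nonneg {q : E (n + 1)} (hf : ContDiffAt ℝ 2 f (projCLM n q))
    (hq : foldFunction f lam q = 0)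
    (hgrad : 0 ≤ 2 * f (projCLM n q) - fderiv ℝ f (projCLM n q) (projCLM n q))
    (hhess : ∀ v, fderiv ℝ (fderiv ℝ f) (projCLM n q) v v ≤ 0) (y : E (n + 1)) :
    0 ≤ foldHessian f lam q y y := by
  -- `DF(q) q = 2 xₙ₊₁² - lam² x · Df`; the fold equation replaces `xₙ₊₁²` by `lam² f`.
  have h1 : fderiv ℝ (foldFunction f lam) q q =
      lam ^ 2 * (2 * f (projCLM n q) - fderiv ℝ f (projCLM n q) (projCLM n q)) := by
    rw [(hasFDerivAt_foldFunction (hf.differentiableAt two_ne_zero)).fderiv]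
    simp only [foldFunction] at hq
    simp only [sub_apply, smul_apply, smul_eq_mul, ContinuousLinearMap.comp_apply]
    linear_combination 2 * hq
  rw [foldHessian_apply, fderiv_fderiv_foldFunction hf, h1]
  have h2 := mul_nonneg (mul_nonneg (sq_nonneg lam) hgrad) (hyperbolicForm_nonneg q y)
  have h3 := mul_nonneg (sq_nonneg lam) (neg_nonneg.2 (hhess (projCLM n y)))
  nlinarith [sq_nonneg (lastCLM n y)]

theorem curvatureBoundedBelow_fold (hU : IsOpen U) (hf : ContDiffOn ℝ 2 f U)
    (hreg : ∀ x ∈ U, f x = 0 → fderiv ℝ f x ≠ 0)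
    (hgrad : ∀ x ∈ U, 0 ≤ f x → 0 ≤ 2 * f x - fderiv ℝ f x x)
    (hhess : ∀ x ∈ U, 0 ≤ f x → ∀ v, fderiv ℝ (fderiv ℝ f) x v v ≤ 0) (hlam : lam ≠ 0) :
    CurvatureBoundedBelow hyperbolicMetric (fold U f lam) (-1) := by
  have hO : IsOpen (projCLM n ⁻¹' U) := hU.preimage (projCLM n).continuous
  have hF : ContDiffOn ℝ 2 (foldFunction f lam) (projCLM n ⁻¹' U) := contDiffOn_foldFunction hf
  have hfc : ∀ q, projCLM n q ∈ U → ContDiffAt ℝ 2 f (projCLM n q) := fun q hq =>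
    hf.contDiffAt (hU.mem_nhds hq)
  have hdF : ∀ q, projCLM n q ∈ U → foldFunction f lam q = 0 →
      fderiv ℝ (foldFunction f lam) q ≠ 0 := fun q hq h0 =>
    fderiv_foldFunction_ne_zero hlam ((hfc q hq).differentiableAt two_ne_zero) (hreg _ hq) h0
  rw [fold_eq]
  refine ⟨fun q hq => exists_isLocalParam_levelSet hO hF hq.1 hq.2 (hdF q hq.1 hq.2),
    fun V φ hφ => ⟨hypersurfaceCurvature φ, isCurvatureTensor_hypersurfaceCurvature hφ.isOpen
      hφ.contDiffOn hφ.immersion, fun u hu v w hvw => ?_⟩⟩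
  obtain ⟨hqU, hq0⟩ : projCLM n (φ u) ∈ U ∧ foldFunction f lam (φ u) = 0 := hφ.mapsTo hu
  have hφc : ContDiffAt ℝ 2 φ u := hφ.contDiffOn.contDiffAt (hφ.isOpen.mem_nhds hu)
  have hFc : ContDiffAt ℝ 2 (foldFunction f lam) (φ u) := hF.contDiffAt (hO.mem_nhds hqU)
  have hzero : foldFunction f lam ∘ φ =ᶠ[nhds u] fun _ => 0 := by
    filter_upwards [hφ.isOpen.mem_nhds hu] with y hy using (hφ.mapsTo hy).2
  -- The fold lies over `{f ≥ 0}`, the only place where the gradient and Hessian conditions are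
  -- assumed.
  have hfpos : 0 ≤ f (projCLM n (φ u)) := by
    have h1 : lam ^ 2 * f (projCLM n (φ u)) = lastCLM n (φ u) ^ 2 := (sub_eq_zero.1 hq0).symm
    have h2 : 0 < lam ^ 2 := by positivity
    exact (mul_nonneg_iff_of_pos_left h2).1 (h1 ▸ sq_nonneg _)
  have htan : ∀ v, fderiv ℝ (foldFunction f lam) (φ u) (fderiv ℝ φ u v) = 0 := fun v => by
    have h1 := fderiv_comp u (hFc.differentiableAt two_ne_zero) (hφc.differentiableAt two_ne_zero)
    rw [hzero.fderiv_eq] at h1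
    simpa using (DFunLike.congr_fun h1 v).symm
  -- The second derivative of `F ∘ φ = 0` trades `DF(D²φ)` for `-D²F`; the correction term of
  -- `covariantHessian` supplies the summand with `DF(q) q`.
  have hsecond : ∀ v w, fderiv ℝ (foldFunction f lam) (φ u) (covariantHessian φ u v w)
      = -foldHessian f lam (φ u) (fderiv ℝ φ u v) (fderiv ℝ φ u w) := fun v w => by
    have h1 := fderiv_fderiv_comp hFc hφc v w
    rw [hzero.fderiv.fderiv_eq] at h1
    have h2 : fderiv ℝ (fderiv ℝ fun _ : E n => (0 : ℝ)) u = 0 := by simp [fderiv_fun_const]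
    rw [h2] at h1
    simp only [zero_apply] at h1
    rw [foldHessian_apply, covariantHessian, map_sub, map_smul, smul_eq_mul]
    linear_combination -h1
  refine neg_one_le_sectionalCurvature hφ.isOpen hφ.contDiffOn hu (hφ.immersion u hu)
    (fderiv ℝ (foldFunction f lam) (φ u) : E (n + 1) →ₗ[ℝ] ℝ)
    (fun h => hdF _ hqU hq0 (by ext x; exact DFunLike.congr_fun h x)) htan (fun v w => ?_) hvw
  simp only [ContinuousLinearMap.coe_coe, hsecond, neg_sq, neg_mul_neg]
  -- Cauchy–Schwarz for the positive semidefinite form `foldHessian`; the sign in `hsecond` cancels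
  -- in products.
  exact LinearMap.BilinForm.apply_sq_le_of_symm _
    (foldHessian_nonneg (hfc _ hqU) hq0 (hgrad _ hqU hfpos) (hhess _ hqU hfpos))
    ⟨foldHessian_comm (hfc _ hqU)⟩ _ _

end Fold

end Billiard

theorem mainTheorem5 (n : ℕ) (K : Set (Billiard.E n)) (hK : Billiard.IsBilliardTable K)
    (p₀ : Billiard.E n) (hp₀ : p₀ ∈ frontier K)
    (U : Set (Billiard.E n)) (f : Billiard.E n → ℝ)
    (hf : Billiard.IsDefiningFunction K (frontier K) p₀ U f)
    (hgrad : ∀ x ∈ K ∩ U, 0 ≤ 2 * f x - inner ℝ x (gradient f x))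
    (hhess : ∀ x ∈ K ∩ U, ∀ v : Billiard.E n, fderiv ℝ (fderiv ℝ f) x v v ≤ 0) :
    (∀ lam ∈ Ioo (0 : ℝ) 1,
      Billiard.CurvatureBoundedBelow Billiard.hyperbolicMetric (Billiard.fold U f lam) (-1)) ∧
    Billiard.AssumptionH Billiard.hyperbolicMetric K p₀ := by
  have hmem : ∀ x ∈ U, 0 ≤ f x → x ∈ K ∩ U := fun x hx h => by
    rw [hf.set_eq]
    exact ⟨hx, h⟩
  have hbound : ∀ lam ∈ Ioo (0 : ℝ) 1,
      Billiard.CurvatureBoundedBelow Billiard.hyperbolicMetric (Billiard.fold U f lam) (-1) :=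
    fun lam hlam => Billiard.curvatureBoundedBelow_fold hf.isOpen hf.isC2.1 hf.regular
      (fun x hx h => by
        have := hgrad x (hmem x hx h)
        rwa [inner_gradient_right, conj_trivial] at this)
      (fun x hx h => hhess x (hmem x hx h)) hlam.1.ne'
  exact ⟨hbound, U, f, hf, -1, hbound⟩
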